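/- Let $\beta\in(0,2]$ and $\sigma>0$. Let $W$ be a standard symmetric stable process of index $\beta$, that is, a real Lévy process with $\mathbb{E}(e^{iuW_t})=e^{-t|u|^\beta/2}$ for all $t\ge 0$ and $u\in\mathbb{R}$ (a Wiener process when $\beta=2$), let $Y$ be a standard Poisson process (jumps of size $1$, intensity $1$) independent of $W$, and let $X_t=\sigma(W_t+Y_t)$. Let $h_\beta$ be the continuous density of $W_1$; it is positive and differentiable, and the integrals $$\mathcal{I}(\beta)=\int_{\mathbb{R}}\frac{(h_\beta(w)+w\,h_\beta'(w))^2}{h_\beta(w)}\,dw,\qquad \mathcal{J}(\beta)=\int_{\mathbb{R}}\frac{h_\beta'(w)^2}{h_\beta(w)}\,dw$$ are finite. For $\Delta>0$ the variable $X_\Delta$ has a continuous, positive density $p_\Delta(\cdot\,|\,\sigma)$ which is differentiable in $\sigma$, and the Fisher information for estimating $\sigma$ from the observation of the single variable $X_\Delta$, $$I'_\Delta=\int_{\mathbb{R}}\frac{(\partial_\sigma p_\Delta(x\,|\,\sigma))^2}{p_\Delta(x\,|\,\sigma)}\,dx,$$ is finite. As $\Delta\downarrow 0$, with $\beta$ and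 $\sigma$ fixed, $$I'_\Delta\;\longrightarrow\;\frac{1}{\sigma^2}\,(\mathcal{I}(\beta)+\mathcal{J}(\beta))\quad\text{if }\beta=2,\qquad\qquad \Delta^{2/\beta-1}\,I'_\Delta\;\longrightarrow\;\frac{1}{\sigma^2}\,\mathcal{J}(\beta)\quad\text{if }\beta\in(0,2).$$ -/

import Mathlib

open MeasureTheory ProbabilityTheory Filter Topology
open scoped NNReal ENNReal

noncomputable section

namespace LevyFisher

/-- `X`, indexed by the times `t ≥ 0`, is a real Lévy process under `P`: it starts at `0`, has
independent and stationary increments, and almost all of its paths are right-continuous with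
left limits. -/
structure IsLevyProcess {Ω : Type*} [MeasurableSpace Ω] (X : ℝ≥0 → Ω → ℝ) (P : Measure Ω) :
    Prop where
  measurable : ∀ t, Measurable (X t)
  zero : ∀ᵐ ω ∂P, X 0 ω = 0
  indep : HasIndepIncrements X P
  stationary : ∀ s t : ℝ≥0, IdentDistrib (fun ω => X (s + t) ω - X s ω) (X t) P P
  cadlag : ∀ᵐ ω ∂P, ∀ t : ℝ≥0,
    ContinuousWithinAt (fun s => X s ω) (Set.Ioi t) t ∧
      ∃ l : ℝ, Tendsto (fun s => X s ω) (𝓝[<] t) (𝓝 l)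

/-- `W` is a standard symmetric stable process of index `β`, normalized so that
`E exp (i u W_t) = exp (- t |u| ^ β / 2)`; for `β = 2` this is a standard Wiener process. -/
structure IsSymmetricStableProcess {Ω : Type*} [MeasurableSpace Ω] (β : ℝ)
    (W : ℝ≥0 → Ω → ℝ) (P : Measure Ω) : Prop extends IsLevyProcess W P where
  charFun_eq : ∀ (t : ℝ≥0) (u : ℝ),
    charFun (P.map (W t)) u = ((Real.exp (-(t * |u| ^ β) / 2) : ℝ) : ℂ)

/-- `Y` is a standard Poisson process (jumps of size one, intensity one). -/
structure IsStandardPoissonProcess {Ω : Type*} [MeasurableSpace Ω]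
    (Y : ℝ≥0 → Ω → ℝ) (P : Measure Ω) : Prop extends IsLevyProcess Y P where
  law_eq : ∀ t : ℝ≥0, P.map (Y t) = (poissonMeasure t).map (Nat.cast : ℕ → ℝ)

/-- `f` is a continuous density of `μ` with respect to Lebesgue measure. -/
structure IsContinuousDensity (μ : Measure ℝ) (f : ℝ → ℝ) : Prop where
  continuous : Continuous f
  nonneg : ∀ x, 0 ≤ f x
  eq_withDensity : μ = volume.withDensity (fun x => ENNReal.ofReal (f x))

/-- A measure has at most one continuous density. -/
theorem IsContinuousDensity.unique {μ : Measure ℝ} [SFinite μ] {f g : ℝ → ℝ}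
    (hf : IsContinuousDensity μ f) (hg : IsContinuousDensity μ g) : f = g := by
  have h := hf.eq_withDensity.symm.trans hg.eq_withDensity
  rw [withDensity_eq_iff_of_sigmaFinite hf.continuous.measurable.ennreal_ofReal.aemeasurable
    hg.continuous.measurable.ennreal_ofReal.aemeasurable] at h
  refine (hf.continuous.ae_eq_iff_eq volume hg.continuous).1 ?_
  filter_upwards [h] with x hx
  exact (ENNReal.ofReal_eq_ofReal_iff (hf.nonneg x) (hg.nonneg x)).1 hx

open Classical in
/-- The continuous density of `μ` (and `0` if there is none). -/
def continuousDensity (μ : Measure ℝ) : ℝ → ℝ :=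
  if h : ∃ f, IsContinuousDensity μ f then h.choose else 0

/-- The integrand `(∂ₛ p(x | s))² / p(x | s)` of the Fisher information at the point `s` of a
statistical model `s ↦ μ s` on the real line, `p(· | s)` being the continuous density of `μ s`. -/
def fisherIntegrand (μ : ℝ → Measure ℝ) (s x : ℝ) : ℝ :=
  (deriv (fun r => continuousDensity (μ r) x) s) ^ 2 / continuousDensity (μ s) x

/-- The Fisher information `∫ (∂ₛ p(x | s))² / p(x | s) dx` at `s` of the model `s ↦ μ s`. -/
def fisherInformation (μ : ℝ → Measure ℝ) (s : ℝ) : ℝ :=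
  ∫ x, fisherIntegrand μ s x

/-- The Fisher information at the point `s > 0` of the model `s ↦ μ s`, `s > 0`, makes sense and is
finite: there are continuous densities, they are positive and differentiable in the parameter
at `s`, and the integral that defines the information converges. -/
structure HasFiniteFisherInformation (μ : ℝ → Measure ℝ) (s : ℝ) : Prop where
  density : ∀ r, 0 < r → IsContinuousDensity (μ r) (continuousDensity (μ r))
  pos : ∀ x, 0 < continuousDensity (μ s) x
  differentiableAt : ∀ x, DifferentiableAt ℝ (fun r => continuousDensity (μ r) x) s
  integrable : Integrable (fisherIntegrand μ s)

/-- The law of `X_Δ = σ (W_Δ + Y_Δ)` as a function of `σ`. -/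
def multiplicativeLaw {Ω : Type*} [MeasurableSpace Ω] (P : Measure Ω) (W Y : ℝ≥0 → Ω → ℝ)
    (Δ : ℝ≥0) (σ : ℝ) : Measure ℝ :=
  P.map (fun ω => σ * (W Δ ω + Y Δ ω))

/-- The density `h_β` of the symmetric stable law with characteristic function
`exp (- |u| ^ β / 2)`, by Fourier inversion. -/
def stableDensity (β w : ℝ) : ℝ :=
  (1 / (2 * Real.pi)) * ∫ u : ℝ, Real.cos (u * w) * Real.exp (-(|u| ^ β) / 2)

/-- `(h_β(w) + w h_β'(w))² / h_β(w)`. -/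
def scaleIntegrand (β w : ℝ) : ℝ :=
  (stableDensity β w + w * deriv (stableDensity β) w) ^ 2 / stableDensity β w

/-- `h_β'(w)² / h_β(w)`. -/
def translationIntegrand (β w : ℝ) : ℝ :=
  (deriv (stableDensity β) w) ^ 2 / stableDensity β w

/-- The constant `𝓘(β) = ∫ (h_β + w h_β')² / h_β dw`. -/
def scaleInformation (β : ℝ) : ℝ := ∫ w, scaleIntegrand β w

/-- The constant `𝓙(β) = ∫ h_β'² / h_β dw`. -/
def translationInformation (β : ℝ) : ℝ := ∫ w, translationIntegrand β w

end LevyFisher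

end

/-!
The density of `X_Δ` at scale `σ` is `q(x / σ) / σ`, where `q` is the density of `W_Δ + Y_Δ`, so the
Fisher information is `σ⁻² ∫ (q + z q')² / q dz`. Given that `Y_Δ = k`, the variable `W_Δ + Y_Δ` has
the law of `c (V + k / c)`, with `c = Δ ^ (1 / β)` and `V` of density `h = h_β`, and the conditional
information for its scale is `𝓘 + 2 (k / c) ∫ (h + v h') h' / h + (k / c)² 𝓙`.

*Upper bound* (`integrable_noisyIntegrand`). The functional `(a, b) ↦ a² / b` is convex
(`sq_integral_le`), so the information is at most its conditional mean. After multiplication by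
`c² / Δ = Δ ^ (2 / β - 1)` this is `(c² / Δ) 𝓘 + O(c) + (1 + Δ) 𝓙`.

*Lower bound* (`tendsto_window_zero`, `tendsto_window_one`). On the windows `z = c w` and
`z = 1 + c w` only the terms `k = 0`, respectively `k = 1`, of the mixture matter, and the
normalized integrands converge pointwise to `lim (c² / Δ) (h + w h')² / h` and `h'² / h`. Fatou's
lemma gives a lower limit that matches the upper bound. In the window at `1` the term `k = 0` is
negligible since `h` and `w h'` are `o(x ^ (-β))` at distance `x = 1 / c`.

The facts on `h` that this needs all come from its being a mixture of centred Gaussian densities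
over a random variance (`exists_isStableMixing`, `stableDensity_eq`), which is a positive stable
variable of index `β / 2` if `β < 2`, and is constant if `β = 2`. Positivity and unimodality are
immediate; the finiteness of `𝓘` and `𝓙` follows from the same convexity and from the moment of
order `-1` of the variance; `w h'(w)` is bounded by `4 h(w / √2)`; and unimodality turns the bound of
the tail probability by the characteristic function into a bound for `h`. The positive stable law
is a limit point of normalized sums of Pareto variables, through Laplace transforms and Prokhorov's
theorem.
-/

noncomputable section

namespace LevyFisher

/-! ### The positive stable law -/

/-- The integrand `(1 - exp (-l t)) α t ^ (-1 - α)` of the Laplace exponent of the positive stable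
law, whose Lévy density is `α t ^ (-1 - α)`. -/
def laplaceIntegrand (α l t : ℝ) : ℝ := (1 - Real.exp (-(l * t))) * (α * t ^ (-1 - α))

lemma laplaceIntegrand_nonneg {α l t : ℝ} (hα : 0 < α) (hl : 0 ≤ l) (ht : 0 < t) :
    0 ≤ laplaceIntegrand α l t := by
  have : Real.exp (-(l * t)) ≤ 1 := Real.exp_le_one_iff.2 (by nlinarith)
  have h2 : 0 < t ^ (-1 - α) := Real.rpow_pos_of_pos ht _
  unfold laplaceIntegrand
  have : 0 ≤ 1 - Real.exp (-(l * t)) := by linarith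
  positivity

lemma measurable_laplaceIntegrand (α l : ℝ) : Measurable (laplaceIntegrand α l) := by
  unfold laplaceIntegrand; fun_prop

lemma integrableOn_laplaceIntegrand {α l : ℝ} (hα : 0 < α) (hα1 : α < 1) (hl : 0 ≤ l) :
    IntegrableOn (laplaceIntegrand α l) (Set.Ioi 0) := by
  rw [← Set.Ioc_union_Ioi_eq_Ioi (zero_le_one' ℝ)]
  refine IntegrableOn.union ?_ ?_
  · rw [integrableOn_Ioc_iff_integrableOn_Ioo]
    have h1 : IntegrableOn (fun t : ℝ => l * α * t ^ (-α)) (Set.Ioo 0 1) :=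
      ((intervalIntegral.integrableOn_Ioo_rpow_iff one_pos).2 (by linarith)).const_mul _
    refine h1.mono' (measurable_laplaceIntegrand α l).aestronglyMeasurable ?_
    refine (ae_restrict_iff' measurableSet_Ioo).2 (ae_of_all _ fun t ht => ?_)
    rw [Real.norm_of_nonneg (laplaceIntegrand_nonneg hα hl ht.1)]
    have h2 : t ^ (-α) = t * t ^ (-1 - α) := by
      rw [← Real.rpow_one_add' ht.1.le (by linarith)]; congr 1; ring
    have h3 : 0 < t ^ (-1 - α) := Real.rpow_pos_of_pos ht.1 _
    have h4 : 1 - Real.exp (-(l * t)) ≤ l * t := by linarith [Real.add_one_le_exp (-(l * t))]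
    rw [h2]
    unfold laplaceIntegrand
    calc _ ≤ (l * t) * (α * t ^ (-1 - α)) := by gcongr
      _ = _ := by ring
  · have h1 : IntegrableOn (fun t : ℝ => α * t ^ (-1 - α)) (Set.Ioi 1) :=
      (integrableOn_Ioi_rpow_of_lt (by linarith) one_pos).const_mul _
    refine h1.mono' (measurable_laplaceIntegrand α l).aestronglyMeasurable ?_
    refine (ae_restrict_iff' measurableSet_Ioi).2 (ae_of_all _ fun t ht => ?_)
    have ht0 : (0 : ℝ) < t := one_pos.trans ht
    rw [Real.norm_of_nonneg (laplaceIntegrand_nonneg hα hl ht0)]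
    have h3 : 0 < t ^ (-1 - α) := Real.rpow_pos_of_pos ht0 _
    unfold laplaceIntegrand
    have := Real.exp_pos (-(l * t))
    calc _ ≤ 1 * (α * t ^ (-1 - α)) := by gcongr; linarith
      _ = _ := by ring

/-- The Laplace exponent of the positive stable law with Lévy density `α t ^ (-1 - α)`. -/
def laplaceExponent (α l : ℝ) : ℝ := ∫ t in Set.Ioi (0 : ℝ), laplaceIntegrand α l t

lemma laplaceExponent_eq {α l : ℝ} (hα : 0 < α) (hl : 0 ≤ l) :
    laplaceExponent α l = laplaceExponent α 1 * l ^ α := by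
  rcases hl.eq_or_lt with rfl | hl
  · simp [laplaceExponent, laplaceIntegrand, Real.zero_rpow hα.ne']
  have h := integral_comp_mul_left_Ioi (laplaceIntegrand α 1) 0 hl
  have h2 : ∀ t ∈ Set.Ioi (0 : ℝ),
      laplaceIntegrand α 1 (l * t) = l ^ (-1 - α) * laplaceIntegrand α l t := by
    intro t ht
    unfold laplaceIntegrand
    rw [Real.mul_rpow hl.le (le_of_lt ht)]
    ring_nf
  rw [setIntegral_congr_fun measurableSet_Ioi h2, integral_const_mul, mul_zero, smul_eq_mul] at h
  change l ^ (-1 - α) * laplaceExponent α l = l⁻¹ * laplaceExponent α 1 at h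
  have h3 : l ^ (-1 - α) = l⁻¹ * (l ^ α)⁻¹ := by
    rw [sub_eq_add_neg, Real.rpow_add hl, Real.rpow_neg_one, Real.rpow_neg hl.le]
  rw [h3] at h
  have : 0 < l ^ α := Real.rpow_pos_of_pos hl _
  field_simp at h
  linarith

lemma laplaceExponent_one_pos {α : ℝ} (hα : 0 < α) (hα1 : α < 1) : 0 < laplaceExponent α 1 := by
  unfold laplaceExponent
  rw [setIntegral_pos_iff_support_of_nonneg_ae]
  · have : Function.support (laplaceIntegrand α 1) ∩ Set.Ioi 0 = Set.Ioi 0 := by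
      refine Set.inter_eq_right.2 fun t ht => ?_
      have h3 : 0 < t ^ (-1 - α) := Real.rpow_pos_of_pos ht _
      have h4 : Real.exp (-(1 * t)) < 1 := Real.exp_lt_one_iff.2 (by simpa using ht)
      have : 0 < 1 - Real.exp (-(1 * t)) := by linarith
      simp only [Function.mem_support, laplaceIntegrand]
      positivity
    rw [this]; simp
  · exact (ae_restrict_iff' measurableSet_Ioi).2
      (ae_of_all _ fun t ht => laplaceIntegrand_nonneg hα zero_le_one ht)
  · exact integrableOn_laplaceIntegrand hα hα1 zero_le_one

/-- The law of `ξ / n ^ (1 / α)`, where `ξ` is Pareto distributed: `P(ξ > t) = t ^ (-α)` for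
`t ≥ 1`. -/
def scaledPareto (α : ℝ) (n : ℕ) : Measure ℝ≥0 :=
  ((volume.restrict (Set.Ioi ((n : ℝ) ^ (-(1 / α))))).withDensity
    (fun t => ENNReal.ofReal (α * t ^ (-1 - α) / n))).map Real.toNNReal

lemma integral_scaledPareto {α : ℝ} (hα : 0 < α) {n : ℕ} (hn : n ≠ 0) {f : ℝ≥0 → ℝ}
    (hf : Measurable f) :
    ∫ s, f s ∂(scaledPareto α n) =
      ∫ t in Set.Ioi ((n : ℝ) ^ (-(1 / α))), α * t ^ (-1 - α) / n * f t.toNNReal := by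
  have hε : 0 < (n : ℝ) ^ (-(1 / α)) := Real.rpow_pos_of_pos (by positivity) _
  unfold scaledPareto
  rw [integral_map measurable_real_toNNReal.aemeasurable hf.aestronglyMeasurable,
    integral_withDensity_eq_integral_toReal_smul (by fun_prop) (by simp)]
  refine setIntegral_congr_fun measurableSet_Ioi fun t ht => ?_
  have h3 : 0 < t ^ (-1 - α) := Real.rpow_pos_of_pos (hε.trans ht) _
  simp only [smul_eq_mul]
  rw [ENNReal.toReal_ofReal (by positivity)]

lemma integral_pareto_density {α : ℝ} (hα : 0 < α) {n : ℕ} (hn : n ≠ 0) :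
    ∫ t in Set.Ioi ((n : ℝ) ^ (-(1 / α))), α * t ^ (-1 - α) / n = 1 := by
  have hn' : (0 : ℝ) < n := by positivity
  have hε : 0 < (n : ℝ) ^ (-(1 / α)) := Real.rpow_pos_of_pos hn' _
  have h1 : (∫ t in Set.Ioi ((n : ℝ) ^ (-(1 / α))), α * t ^ (-1 - α) / n) =
      ∫ t in Set.Ioi ((n : ℝ) ^ (-(1 / α))), α / n * t ^ (-1 - α) := by
    congr 1; ext t; ring
  rw [h1, integral_const_mul, integral_Ioi_rpow_of_lt (by linarith) hε, ← Real.rpow_mul hn'.le]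
  have : -(1 / α) * (-1 - α + 1) = 1 := by field_simp; ring
  rw [this, Real.rpow_one]
  have : -1 - α + 1 = -α := by ring
  rw [this]
  field_simp

lemma integrableOn_pareto_density {α : ℝ} (hα : 0 < α) {n : ℕ} (hn : n ≠ 0) :
    IntegrableOn (fun t : ℝ => α * t ^ (-1 - α) / n) (Set.Ioi ((n : ℝ) ^ (-(1 / α)))) := by
  have hn' : (0 : ℝ) < n := by positivity
  have hε : 0 < (n : ℝ) ^ (-(1 / α)) := Real.rpow_pos_of_pos hn' _
  exact ((integrableOn_Ioi_rpow_of_lt (by linarith) hε).const_mul _).div_const _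

lemma isProbabilityMeasure_scaledPareto {α : ℝ} (hα : 0 < α) {n : ℕ} (hn : n ≠ 0) :
    IsProbabilityMeasure (scaledPareto α n) := by
  have hε : 0 < (n : ℝ) ^ (-(1 / α)) := Real.rpow_pos_of_pos (by positivity) _
  constructor
  unfold scaledPareto
  rw [Measure.map_apply measurable_real_toNNReal MeasurableSet.univ, Set.preimage_univ,
    withDensity_apply _ MeasurableSet.univ, Measure.restrict_univ,
    ← ofReal_integral_eq_lintegral_ofReal (integrableOn_pareto_density hα hn),
    integral_pareto_density hα hn, ENNReal.ofReal_one]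
  refine (ae_restrict_iff' measurableSet_Ioi).2 (ae_of_all _ fun t ht => ?_)
  have h3 : 0 < t ^ (-1 - α) := Real.rpow_pos_of_pos (hε.trans ht) _
  simp only [Pi.zero_apply]
  positivity

/-- The Laplace exponent truncated to the jumps larger than `n ^ (-1 / α)`. -/
def truncatedExponent (α l : ℝ) (n : ℕ) : ℝ :=
  ∫ t in Set.Ioi ((n : ℝ) ^ (-(1 / α))), laplaceIntegrand α l t

lemma Ioi_rpow_subset (α : ℝ) (n : ℕ) : Set.Ioi ((n : ℝ) ^ (-(1 / α))) ⊆ Set.Ioi 0 :=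
  Set.Ioi_subset_Ioi (Real.rpow_nonneg (by positivity) _)

lemma laplace_scaledPareto {α l : ℝ} (hα : 0 < α) (hα1 : α < 1) (hl : 0 ≤ l) {n : ℕ}
    (hn : n ≠ 0) :
    ∫ s : ℝ≥0, Real.exp (-(l * s)) ∂(scaledPareto α n) = 1 + -(truncatedExponent α l n) / n := by
  have hε : 0 < (n : ℝ) ^ (-(1 / α)) := Real.rpow_pos_of_pos (by positivity) _
  rw [integral_scaledPareto hα hn (by fun_prop)]
  have h1 : ∀ t ∈ Set.Ioi ((n : ℝ) ^ (-(1 / α))),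
      α * t ^ (-1 - α) / n * Real.exp (-(l * (t.toNNReal : ℝ))) =
        α * t ^ (-1 - α) / n - laplaceIntegrand α l t / n := by
    intro t ht
    rw [Real.coe_toNNReal _ (hε.trans ht).le]
    unfold laplaceIntegrand
    ring
  rw [setIntegral_congr_fun measurableSet_Ioi h1, integral_sub, integral_pareto_density hα hn,
    integral_div]
  · unfold truncatedExponent; ring
  · exact integrableOn_pareto_density hα hn
  · exact ((integrableOn_laplaceIntegrand hα hα1 hl).mono_set (Ioi_rpow_subset α n)).div_const _

lemma truncatedExponent_le {α l : ℝ} (hα : 0 < α) (hα1 : α < 1) (hl : 0 ≤ l) (n : ℕ) :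
    truncatedExponent α l n ≤ laplaceExponent α l := by
  refine setIntegral_mono_set (integrableOn_laplaceIntegrand hα hα1 hl) ?_
    (Ioi_rpow_subset α n).eventuallyLE
  exact (ae_restrict_iff' measurableSet_Ioi).2
    (ae_of_all _ fun t ht => laplaceIntegrand_nonneg hα hl ht)

lemma tendsto_truncatedExponent {α l : ℝ} (hα : 0 < α) (hα1 : α < 1) (hl : 0 ≤ l) :
    Tendsto (truncatedExponent α l) atTop (𝓝 (laplaceExponent α l)) := by
  have hε : Tendsto (fun n : ℕ => (n : ℝ) ^ (-(1 / α))) atTop (𝓝 0) :=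
    (tendsto_rpow_neg_atTop (by positivity)).comp tendsto_natCast_atTop_atTop
  have h := (aecover_Ioi_of_Ioi (μ := volume) hε).integral_tendsto_of_countably_generated
    (integrableOn_laplaceIntegrand hα hα1 hl)
  refine h.congr fun n => ?_
  rw [Measure.restrict_restrict measurableSet_Ioi, Set.inter_eq_left.2 (Ioi_rpow_subset α n)]
  rfl

/-- The law of the normalized sum `(ξ₁ + ⋯ + ξₙ) / n ^ (1 / α)` of independent Pareto variables. -/
def paretoSum (α : ℝ) (n : ℕ) : Measure ℝ≥0 :=
  (Measure.pi fun _ : Fin n => scaledPareto α n).map fun x => ∑ i, x i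

lemma isProbabilityMeasure_paretoSum {α : ℝ} (hα : 0 < α) {n : ℕ} (hn : n ≠ 0) :
    IsProbabilityMeasure (paretoSum α n) := by
  have := isProbabilityMeasure_scaledPareto hα hn
  exact Measure.isProbabilityMeasure_map (by fun_prop)

lemma laplace_paretoSum {α l : ℝ} (hα : 0 < α) (hα1 : α < 1) (hl : 0 ≤ l) {n : ℕ}
    (hn : n ≠ 0) :
    ∫ s : ℝ≥0, Real.exp (-(l * s)) ∂(paretoSum α n) =
      (1 + -(truncatedExponent α l n) / n) ^ n := by
  have := isProbabilityMeasure_scaledPareto hα hn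
  unfold paretoSum
  rw [integral_map (by fun_prop) (Measurable.aestronglyMeasurable (by fun_prop))]
  have h1 : ∀ x : Fin n → ℝ≥0, Real.exp (-(l * ((∑ i, x i : ℝ≥0) : ℝ))) =
      ∏ i, Real.exp (-(l * (x i : ℝ))) := by
    intro x
    rw [← Real.exp_sum]
    push_cast
    rw [Finset.mul_sum, Finset.sum_neg_distrib]
  simp_rw [h1]
  rw [integral_fintype_prod_eq_pow (fun s : ℝ≥0 => Real.exp (-(l * (s : ℝ)))), Fintype.card_fin,
    laplace_scaledPareto hα hα1 hl hn]

lemma tendsto_laplace_paretoSum {α l : ℝ} (hα : 0 < α) (hα1 : α < 1) (hl : 0 ≤ l) :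
    Tendsto (fun n => ∫ s : ℝ≥0, Real.exp (-(l * s)) ∂(paretoSum α n)) atTop
      (𝓝 (Real.exp (-laplaceExponent α l))) := by
  have h : Tendsto (fun n : ℕ => (1 + -(truncatedExponent α l n) / n) ^ n) atTop
      (𝓝 (Real.exp (-laplaceExponent α l))) := by
    apply Real.tendsto_one_add_pow_exp_of_tendsto
    refine (tendsto_truncatedExponent hα hα1 hl).neg.congr' ?_
    filter_upwards [eventually_ne_atTop 0] with n hn
    field_simp
  refine h.congr' ?_
  filter_upwards [eventually_ne_atTop 0] with n hn
  rw [laplace_paretoSum hα hα1 hl hn]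

lemma integrable_exp_neg_mul (μ : Measure ℝ≥0) [IsFiniteMeasure μ] {l : ℝ} (hl : 0 ≤ l) :
    Integrable (fun s : ℝ≥0 => Real.exp (-(l * s))) μ := by
  refine Integrable.of_bound (C := 1) (Measurable.aestronglyMeasurable (by fun_prop))
    (ae_of_all _ fun s => ?_)
  rw [Real.norm_of_nonneg (Real.exp_pos _).le, Real.exp_le_one_iff]
  have := s.2
  have : 0 ≤ l * (s : ℝ) := mul_nonneg hl s.2
  linarith

/-- A tail bound that does not depend on `n`: the normalized Pareto sums are tight. -/
lemma paretoSum_Ioi_le {α : ℝ} (hα : 0 < α) (hα1 : α < 1) {n : ℕ} (hn : n ≠ 0) {r : ℝ≥0}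
    (hr : 0 < r) :
    (paretoSum α n).real (Set.Iic r)ᶜ ≤
      laplaceExponent α 1 / (1 - Real.exp (-1)) * (r : ℝ) ^ (-α) := by
  have := isProbabilityMeasure_paretoSum hα hn
  have hr' : (0 : ℝ) < r := hr
  have hl : (0 : ℝ) ≤ (r : ℝ)⁻¹ := by positivity
  have he : 0 < 1 - Real.exp (-1) := by
    have : Real.exp (-1) < 1 := Real.exp_lt_one_iff.2 (by norm_num)
    linarith
  have hint := integrable_exp_neg_mul (paretoSum α n) hl
  have h0 : ∀ s : ℝ≥0, 0 ≤ 1 - Real.exp (-((r : ℝ)⁻¹ * s)) := fun s => by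
    have : Real.exp (-((r : ℝ)⁻¹ * s)) ≤ 1 :=
      Real.exp_le_one_iff.2 (by have := s.2; simp only [Left.neg_nonpos_iff]; positivity)
    linarith
  have hM := mul_meas_ge_le_integral_of_nonneg (μ := paretoSum α n)
    (f := fun s : ℝ≥0 => 1 - Real.exp (-((r : ℝ)⁻¹ * s))) (ae_of_all _ h0)
    ((integrable_const _).sub hint) (1 - Real.exp (-1))
  rw [integral_sub (integrable_const _) hint, laplace_paretoSum hα hα1 hl hn] at hM
  simp only [integral_const, probReal_univ, smul_eq_mul, mul_one] at hM
  have hn' : (0 : ℝ) < n := by positivity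
  -- Bernoulli's inequality bounds the Laplace transform from below, uniformly in `n`
  have hB : 1 - truncatedExponent α (r : ℝ)⁻¹ n ≤
      (1 + -(truncatedExponent α (r : ℝ)⁻¹ n) / n) ^ n := by
    have hge : 0 ≤ 1 + -(truncatedExponent α (r : ℝ)⁻¹ n) / n := by
      have := isProbabilityMeasure_scaledPareto hα hn
      rw [← laplace_scaledPareto hα hα1 hl hn]
      exact integral_nonneg fun s => (Real.exp_pos _).le
    have := one_add_mul_le_pow (a := -(truncatedExponent α (r : ℝ)⁻¹ n) / n) (by linarith) n
    refine le_trans (le_of_eq ?_) this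
    field_simp
    ring
  have hT := truncatedExponent_le hα hα1 hl n
  rw [laplaceExponent_eq hα hl, Real.inv_rpow hr'.le, ← Real.rpow_neg hr'.le] at hT
  have hsub : (paretoSum α n).real (Set.Iic r)ᶜ ≤ (paretoSum α n).real
      {s : ℝ≥0 | 1 - Real.exp (-1) ≤ 1 - Real.exp (-((r : ℝ)⁻¹ * s))} := by
    refine measureReal_mono fun s hs => ?_
    have hs' : (r : ℝ) < s := by simpa using hs
    have : 1 ≤ (r : ℝ)⁻¹ * s := by
      rw [inv_mul_eq_div, one_le_div hr']; exact hs'.le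
    simp only [Set.mem_ofPred_eq]
    gcongr
  calc _ ≤ _ := hsub
    _ ≤ (laplaceExponent α 1 * (r : ℝ) ^ (-α)) / (1 - Real.exp (-1)) := by
      rw [le_div_iff₀ he]; linarith
    _ = _ := by ring

/-- A limit point of the normalized Pareto sums is a positive stable law of index `α`. -/
theorem exists_positive_stable {α : ℝ} (hα : 0 < α) (hα1 : α < 1) :
    ∃ μ : ProbabilityMeasure ℝ≥0, ∀ l : ℝ, 0 ≤ l →
      ∫ s : ℝ≥0, Real.exp (-(l * s)) ∂(μ : Measure ℝ≥0) =
        Real.exp (-(laplaceExponent α 1 * l ^ α)) := by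
  let P : ℕ → ProbabilityMeasure ℝ≥0 := fun n =>
    ⟨paretoSum α (n + 1), isProbabilityMeasure_paretoSum hα n.succ_ne_zero⟩
  let u : ℕ → ℝ≥0 := fun j =>
    (laplaceExponent α 1 / (1 - Real.exp (-1)) * ((j : ℝ) + 1) ^ (-α)).toNNReal
  have hu : Tendsto u atTop (𝓝 0) := by
    have h1 : Tendsto (fun j : ℕ => ((j : ℝ) + 1) ^ (-α)) atTop (𝓝 0) :=
      (tendsto_rpow_neg_atTop hα).comp
        (tendsto_atTop_add_const_right _ _ tendsto_natCast_atTop_atTop)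
    have h2 := tendsto_real_toNNReal (h1.const_mul (laplaceExponent α 1 / (1 - Real.exp (-1))))
    simpa using h2
  have hcomp := isCompact_setOfPred_probabilityMeasure_mass_eq_compl_isCompact_le hu
    (K := fun j : ℕ => Set.Iic ((j : ℝ≥0) + 1))
    (fun j => by rw [← Set.Icc_bot]; exact isCompact_Icc) (Or.inl inferInstance)
  let U : Ultrafilter ℕ := Filter.hyperfilter ℕ
  have hU : (U : Filter ℕ) ≤ atTop := by
    rw [← Nat.cofinite_eq_atTop]; exact Filter.hyperfilter_le_cofinite
  obtain ⟨μ, -, hμ⟩ := hcomp.ultrafilter_le_nhds (U.map P) (by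
    rw [le_principal_iff]
    refine Filter.mem_map.2 (Filter.univ_mem' fun n j => ?_)
    have h := paretoSum_Ioi_le hα hα1 n.succ_ne_zero (r := (j : ℝ≥0) + 1) (by positivity)
    have h' : ((P n (Set.Iic ((j : ℝ≥0) + 1))ᶜ : ℝ≥0) : ℝ) ≤
        laplaceExponent α 1 / (1 - Real.exp (-1)) * ((j : ℝ) + 1) ^ (-α) := by
      push_cast at h
      exact h
    exact NNReal.coe_le_coe.1 (h'.trans (Real.le_coe_toNNReal _)))
  have hμ' : Tendsto P U (𝓝 μ) := hμ
  refine ⟨μ, fun l hl => ?_⟩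
  have h1 := (ProbabilityMeasure.tendsto_iff_forall_integral_tendsto.1 hμ')
    (BoundedContinuousFunction.ofNormedAddCommGroup (fun s : ℝ≥0 => Real.exp (-(l * s)))
      (by fun_prop) 1 (fun s => by
        rw [Real.norm_of_nonneg (Real.exp_pos _).le, Real.exp_le_one_iff]
        have : 0 ≤ l * (s : ℝ) := mul_nonneg hl s.2
        linarith))
  have h2 := ((tendsto_laplace_paretoSum hα hα1 hl).comp (tendsto_add_atTop_nat 1)).mono_left hU
  rw [← laplaceExponent_eq hα hl]
  exact tendsto_nhds_unique h1 h2

/-- `m` is the law of a random variance `S > 0` such that the centred Gaussian law with variance `S`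
is the symmetric stable law of index `β`. -/
structure IsStableMixing (β : ℝ) (m : Measure ℝ≥0) : Prop where
  prob : IsProbabilityMeasure m
  pos : ∀ᵐ s ∂m, 0 < s
  integral_exp : ∀ u : ℝ, ∫ s : ℝ≥0, Real.exp (-(s * u ^ 2 / 2)) ∂m = Real.exp (-(|u| ^ β) / 2)

lemma ae_pos_of_laplace {μ : Measure ℝ≥0} [IsProbabilityMeasure μ] {K α : ℝ} (hK : 0 < K)
    (hα : 0 < α) (h : ∀ l : ℝ, 0 ≤ l →
      ∫ s : ℝ≥0, Real.exp (-(l * s)) ∂μ = Real.exp (-(K * l ^ α))) :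
    ∀ᵐ s ∂μ, 0 < s := by
  have hlim : Tendsto (fun l : ℝ => Real.exp (-(K * l ^ α))) atTop (𝓝 0) :=
    Real.tendsto_exp_neg_atTop_nhds_zero.comp ((tendsto_rpow_atTop hα).const_mul_atTop hK)
  have hle : ∀ l : ℝ, 0 ≤ l → μ.real {0} ≤ Real.exp (-(K * l ^ α)) := by
    intro l hl
    rw [← h l hl]
    have hM := mul_meas_ge_le_integral_of_nonneg (μ := μ)
      (f := fun s : ℝ≥0 => Real.exp (-(l * s))) (ae_of_all _ fun s => (Real.exp_pos _).le)
      (integrable_exp_neg_mul μ hl) 1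
    rw [one_mul] at hM
    refine le_trans (measureReal_mono ?_) hM
    simp
  have h0 : μ.real {0} ≤ 0 :=
    ge_of_tendsto hlim (by filter_upwards [eventually_ge_atTop 0] with l hl using hle l hl)
  have h1 : μ {0} = 0 := by
    have := le_antisymm h0 measureReal_nonneg
    rwa [measureReal_eq_zero_iff] at this
  rw [ae_iff]
  convert h1 using 2
  ext s; simp

/-- The symmetric stable laws are mixtures of centred Gaussian laws. -/
theorem exists_isStableMixing {β : ℝ} (hβ : 0 < β) (hβ2 : β ≤ 2) :
    ∃ m, IsStableMixing β m := by
  rcases hβ2.eq_or_lt with rfl | hβ2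
  · refine ⟨Measure.dirac 1, inferInstance, ?_, fun u => ?_⟩
    · simp [ae_dirac_eq]
    · rw [integral_dirac]
      congr 1
      simp
      ring
  obtain ⟨μ, hμ⟩ := exists_positive_stable (α := β / 2) (by positivity) (by linarith)
  have hK := laplaceExponent_one_pos (α := β / 2) (by positivity) (by linarith)
  set K := laplaceExponent (β / 2) 1
  -- the factor `a` turns the Laplace exponent `K l ^ (β / 2)` at `l = a u ^ 2 / 2` into
  -- `|u| ^ β / 2`
  let a : ℝ≥0 := ⟨2 * (1 / (2 * K)) ^ (2 / β), by positivity⟩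
  have ha : 0 < a := by
    have : (0 : ℝ) < 2 * (1 / (2 * K)) ^ (2 / β) := by positivity
    exact this
  have hpos := ae_pos_of_laplace (μ := (μ : Measure ℝ≥0)) hK (by positivity) hμ
  refine ⟨(μ : Measure ℝ≥0).map (fun s => a * s), Measure.isProbabilityMeasure_map (by fun_prop),
    ?_, fun u => ?_⟩
  · rw [ae_map_iff (by fun_prop) (measurableSet_Ioi (a := (0 : ℝ≥0)))]
    filter_upwards [hpos] with s hs
    positivity
  · rw [integral_map (by fun_prop) (Measurable.aestronglyMeasurable (by fun_prop))]
    have h1 : ∀ s : ℝ≥0, Real.exp (-(((a * s : ℝ≥0) : ℝ) * u ^ 2 / 2)) =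
        Real.exp (-((a * u ^ 2 / 2) * s)) := fun s => by push_cast; ring_nf
    simp_rw [h1]
    rw [hμ _ (by positivity)]
    congr 1
    have h2 : (a : ℝ) * u ^ 2 / 2 = (1 / (2 * K)) ^ (2 / β) * |u| ^ 2 := by
      change 2 * (1 / (2 * K)) ^ (2 / β) * u ^ 2 / 2 = _
      rw [sq_abs]; ring
    rw [h2, Real.mul_rpow (by positivity) (by positivity), ← Real.rpow_mul (by positivity),
      ← Real.rpow_natCast, ← Real.rpow_mul (abs_nonneg u)]
    have h3 : 2 / β * (β / 2) = 1 := by field_simp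
    have h4 : ((2 : ℕ) : ℝ) * (β / 2) = β := by push_cast; ring
    rw [h3, h4, Real.rpow_one]
    field_simp

/-! ### The Cauchy–Schwarz inequality for mixtures -/

/-- `(∫ a)² ≤ (∫ b) (∫ a² / b)`: convexity of `(a, b) ↦ a² / b`, which bounds the Fisher
information of a mixture by the mixture of the Fisher informations. -/
lemma sq_integral_le {Θ : Type*} [MeasurableSpace Θ] {μ : Measure Θ} {a b : Θ → ℝ}
    (hb : ∀ᵐ x ∂μ, 0 < b x) (ia : Integrable a μ) (ib : Integrable b μ)
    (iab : Integrable (fun x => a x ^ 2 / b x) μ) :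
    (∫ x, a x ∂μ) ^ 2 ≤ (∫ x, b x ∂μ) * ∫ x, a x ^ 2 / b x ∂μ := by
  have h : ∀ t : ℝ, 0 ≤ (∫ x, b x ∂μ) * (t * t) + (-2 * ∫ x, a x ∂μ) * t +
      ∫ x, a x ^ 2 / b x ∂μ := by
    intro t
    have h1 : 0 ≤ ∫ x, (b x * (t * t) + (-2 * a x) * t + a x ^ 2 / b x) ∂μ := by
      refine integral_nonneg_of_ae ?_
      filter_upwards [hb] with x hx
      have : b x * (t * t) + (-2 * a x) * t + a x ^ 2 / b x = (b x * t - a x) ^ 2 / b x := by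
        field_simp; ring
      simp only [Pi.zero_apply]
      rw [this]; positivity
    have i1 : Integrable (fun x => b x * (t * t)) μ := ib.mul_const _
    have i2 : Integrable (fun x => -2 * a x * t) μ := (ia.const_mul _).mul_const _
    have i3 : Integrable (fun x => b x * (t * t) + -2 * a x * t) μ := i1.add i2
    rw [integral_add i3 iab, integral_add i1 i2, integral_mul_const, integral_mul_const,
      integral_const_mul] at h1
    exact h1
  have := discrim_le_zero h
  unfold discrim at this
  nlinarith

/-! ### Centred Gaussian densities -/

lemma gaussianPDFReal_zero (s : ℝ≥0) (w : ℝ) :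
    gaussianPDFReal 0 s w = (√(2 * Real.pi * s))⁻¹ * Real.exp (-w ^ 2 / (2 * s)) := by
  simp [gaussianPDFReal]

@[fun_prop]
lemma measurable_gaussianPDFReal_uncurry :
    Measurable (fun p : ℝ≥0 × ℝ => gaussianPDFReal 0 p.1 p.2) := by
  unfold gaussianPDFReal; fun_prop

lemma measurable_gaussianPDFReal_variance (w : ℝ) :
    Measurable (fun s : ℝ≥0 => gaussianPDFReal 0 s w) := by
  unfold gaussianPDFReal; fun_prop

lemma hasDerivAt_gaussianPDFReal (s : ℝ≥0) (w : ℝ) :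
    HasDerivAt (gaussianPDFReal 0 s) (-(w / s) * gaussianPDFReal 0 s w) w := by
  have h1 : gaussianPDFReal 0 s = fun w =>
      (√(2 * Real.pi * s))⁻¹ * Real.exp (-w ^ 2 / (2 * s)) := by
    ext w; exact gaussianPDFReal_zero s w
  rw [h1]
  have h2 : HasDerivAt (fun w : ℝ => -w ^ 2 / (2 * (s : ℝ))) (-(2 * w) / (2 * s)) w := by
    simpa using ((hasDerivAt_pow 2 w).neg.div_const (2 * (s : ℝ)))
  refine (h2.exp.const_mul _).congr_deriv ?_
  have : -(2 * w) / (2 * (s : ℝ)) = -(w / s) := by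
    rw [neg_div, mul_div_mul_left _ _ two_ne_zero]
  rw [this]; ring

lemma gaussianPDFReal_le_of_abs_le {s : ℝ≥0} {x y : ℝ} (h : |x| ≤ |y|) :
    gaussianPDFReal 0 s y ≤ gaussianPDFReal 0 s x := by
  rw [gaussianPDFReal_zero, gaussianPDFReal_zero]
  have := sq_le_sq.2 h
  gcongr

lemma sqrt_le_sqrt_two_pi_mul (s : ℝ≥0) : √(s : ℝ) ≤ √(2 * Real.pi * s) := by
  apply Real.sqrt_le_sqrt
  have := Real.pi_gt_three
  have := s.2
  nlinarith

lemma gaussianPDFReal_le_one_add_inv {s : ℝ≥0} (hs : 0 < s) (w : ℝ) :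
    gaussianPDFReal 0 s w ≤ 1 + (s : ℝ)⁻¹ := by
  have hs' : (0 : ℝ) < s := hs
  have hq : 0 < √(s : ℝ) := Real.sqrt_pos.2 hs'
  calc gaussianPDFReal 0 s w ≤ gaussianPDFReal 0 s 0 :=
        gaussianPDFReal_le_of_abs_le (by simp)
    _ = (√(2 * Real.pi * s))⁻¹ := by rw [gaussianPDFReal_zero]; simp
    _ ≤ (√(s : ℝ))⁻¹ := inv_anti₀ hq (sqrt_le_sqrt_two_pi_mul s)
    _ ≤ 1 + (s : ℝ)⁻¹ := by
      have : ((√(s : ℝ))⁻¹) ^ 2 = (s : ℝ)⁻¹ := by rw [inv_pow, Real.sq_sqrt hs'.le]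
      nlinarith [sq_nonneg ((√(s : ℝ))⁻¹ - 1)]

lemma abs_deriv_gaussianPDFReal_le {s : ℝ≥0} (hs : 0 < s) (w : ℝ) :
    |-(w / s) * gaussianPDFReal 0 s w| ≤ (s : ℝ)⁻¹ := by
  have hs' : (0 : ℝ) < s := hs
  have hq : 0 < √(s : ℝ) := Real.sqrt_pos.2 hs'
  have h1 : |w| ≤ √(s : ℝ) * Real.exp (w ^ 2 / (2 * s)) := by
    apply abs_le_of_sq_le_sq _ (by positivity)
    rw [mul_pow, Real.sq_sqrt hs'.le, ← Real.exp_nat_mul]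
    have : ((2 : ℕ) : ℝ) * (w ^ 2 / (2 * s)) = w ^ 2 / s := by push_cast; field_simp
    rw [this]
    have h2 := Real.add_one_le_exp (w ^ 2 / (s : ℝ))
    calc w ^ 2 = s * (w ^ 2 / s) := by field_simp
      _ ≤ _ := by gcongr; linarith
  have h3 : |w| * gaussianPDFReal 0 s w ≤ 1 := by
    rw [gaussianPDFReal_zero, neg_div, Real.exp_neg]
    have := sqrt_le_sqrt_two_pi_mul s
    have h5 : 0 < √(2 * Real.pi * s) := hq.trans_le this
    rw [← mul_inv, ← div_eq_mul_inv, div_le_one (by positivity)]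
    exact h1.trans (by gcongr)
  rw [abs_mul, abs_neg, abs_div, abs_of_pos hs', abs_of_nonneg (gaussianPDFReal_nonneg _ _ _)]
  calc _ = (|w| * gaussianPDFReal 0 s w) * (s : ℝ)⁻¹ := by ring
    _ ≤ 1 * (s : ℝ)⁻¹ := by gcongr
    _ = _ := one_mul _

/-- A Gaussian density at `w` is the one at `w / √2` times a factor which beats any polynomial in
`w ^ 2 / s`. -/
lemma gaussianPDFReal_eq_mul_div_sqrt_two {s : ℝ≥0} (w : ℝ) :
    gaussianPDFReal 0 s w = Real.exp (-(w ^ 2 / s) / 4) * gaussianPDFReal 0 s (w / √2) := by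
  rw [gaussianPDFReal_zero, gaussianPDFReal_zero, mul_left_comm, ← Real.exp_add, div_pow,
    Real.sq_sqrt zero_le_two]
  congr 2
  ring

lemma sq_div_mul_gaussianPDFReal_le {s : ℝ≥0} (w : ℝ) :
    w ^ 2 / s * gaussianPDFReal 0 s w ≤ 4 * gaussianPDFReal 0 s (w / √2) := by
  rw [gaussianPDFReal_eq_mul_div_sqrt_two w, ← mul_assoc]
  have hs := s.2
  set t := w ^ 2 / (s : ℝ)
  gcongr
  · exact gaussianPDFReal_nonneg _ _ _
  · rw [neg_div, Real.exp_neg, ← div_eq_mul_inv, div_le_iff₀ (Real.exp_pos _)]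
    linarith [Real.add_one_le_exp (t / 4)]

lemma one_sub_sq_mul_gaussianPDFReal_le {s : ℝ≥0} (w : ℝ) :
    (1 - w ^ 2 / s) ^ 2 * gaussianPDFReal 0 s w ≤ 32 * gaussianPDFReal 0 s (w / √2) := by
  rw [gaussianPDFReal_eq_mul_div_sqrt_two w, ← mul_assoc]
  have ht : 0 ≤ w ^ 2 / (s : ℝ) := by positivity
  set t := w ^ 2 / (s : ℝ)
  gcongr
  · exact gaussianPDFReal_nonneg _ _ _
  · rw [neg_div, Real.exp_neg, ← div_eq_mul_inv, div_le_iff₀ (Real.exp_pos _)]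
    have := Real.quadratic_le_exp_of_nonneg (x := t / 4) (by positivity)
    nlinarith

lemma integral_cos_mul_exp {s : ℝ≥0} (hs : 0 < s) (w : ℝ) :
    ∫ u : ℝ, Real.cos (u * w) * Real.exp (-(s * u ^ 2 / 2)) =
      2 * Real.pi * gaussianPDFReal 0 s w := by
  have hs' : (0 : ℝ) < s := hs
  have h := fourierIntegral_gaussian (b := ((s / 2 : ℝ) : ℂ)) (by simpa using hs') (w : ℂ)
  have h1 : ∀ u : ℝ, Real.cos (u * w) * Real.exp (-(s * u ^ 2 / 2)) =
      RCLike.re (Complex.exp (Complex.I * w * u) *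
        Complex.exp (-((s / 2 : ℝ) : ℂ) * (u : ℂ) ^ 2)) := by
    intro u
    have h2 : Complex.I * w * u = ((u * w : ℝ) : ℂ) * Complex.I := by push_cast; ring
    have h3 : -((s / 2 : ℝ) : ℂ) * (u : ℂ) ^ 2 = ((-(s * u ^ 2 / 2) : ℝ) : ℂ) := by
      push_cast; ring
    rw [h2, h3, ← Complex.ofReal_exp, RCLike.re_eq_complex_re, Complex.re_mul_ofReal,
      Complex.exp_ofReal_mul_I_re]
  have hint : Integrable (fun u : ℝ => Complex.exp (Complex.I * w * u) *
        Complex.exp (-((s / 2 : ℝ) : ℂ) * (u : ℂ) ^ 2)) := by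
    have := integrable_cexp_neg_mul_sq (b := ((s / 2 : ℝ) : ℂ)) (by simpa using hs')
    refine this.bdd_mul (c := 1) (by fun_prop) (ae_of_all _ fun u => ?_)
    rw [show Complex.I * w * u = ((u * w : ℝ) : ℂ) * Complex.I by push_cast; ring,
      Complex.norm_exp_ofReal_mul_I]
  simp_rw [h1]
  rw [integral_re hint, h]
  have h4 : ((Real.pi : ℂ) / ((s / 2 : ℝ) : ℂ)) ^ (1 / 2 : ℂ) = ((√(Real.pi / (s / 2)) : ℝ) : ℂ) := by
    rw [Real.sqrt_eq_rpow, Complex.ofReal_cpow (by positivity)]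
    push_cast; rfl
  have h5 : -(w : ℂ) ^ 2 / (4 * ((s / 2 : ℝ) : ℂ)) = ((-w ^ 2 / (2 * s) : ℝ) : ℂ) := by
    push_cast; ring
  rw [h4, h5, ← Complex.ofReal_exp, ← Complex.ofReal_mul, gaussianPDFReal_zero]
  change √(Real.pi / (s / 2)) * Real.exp (-w ^ 2 / (2 * s)) = _
  rw [← mul_assoc]
  congr 1
  have h6 : 0 < √(2 * Real.pi * s) := Real.sqrt_pos.2 (by positivity)
  have h7 : Real.pi / ((s : ℝ) / 2) = (2 * Real.pi) ^ 2 / (2 * Real.pi * s) := by field_simp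
  rw [h7, Real.sqrt_div (by positivity), Real.sqrt_sq (by positivity), div_eq_mul_inv]

lemma integral_abs_mul_exp {s : ℝ≥0} (hs : 0 < s) :
    ∫ u : ℝ, |u| * Real.exp (-(s * u ^ 2 / 2)) = 2 * (s : ℝ)⁻¹ := by
  have hs' : (0 : ℝ) < s := hs
  have h1 : ∀ u : ℝ, |u| * Real.exp (-(s * u ^ 2 / 2)) =
      (fun x : ℝ => x * Real.exp (-(s * x ^ 2 / 2))) |u| := fun u => by simp [sq_abs]
  rw [integral_congr_ae (ae_of_all _ h1),
    integral_comp_abs (f := fun x : ℝ => x * Real.exp (-(s * x ^ 2 / 2)))]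
  congr 1
  have h2 : ∀ x ∈ Set.Ioi (0 : ℝ), x * Real.exp (-(s * x ^ 2 / 2)) =
      x ^ (1 : ℝ) * Real.exp (-(s / 2 : ℝ) * x ^ (2 : ℝ)) := by
    intro x _
    rw [Real.rpow_one, Real.rpow_two]; ring_nf
  rw [setIntegral_congr_fun measurableSet_Ioi h2,
    integral_rpow_mul_exp_neg_mul_rpow two_pos (by norm_num) (by positivity)]
  norm_num [Real.rpow_neg_one]

/-! ### Integrability of the stable characteristic function -/

lemma integrable_abs_pow_mul_exp {β : ℝ} (hβ : 0 < β) (k : ℕ) :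
    Integrable (fun u : ℝ => |u| ^ k * Real.exp (-(|u| ^ β) / 2)) := by
  have h : IntegrableOn (fun u : ℝ => |u| ^ k * Real.exp (-(|u| ^ β) / 2)) (Set.Ioi 0) := by
    refine (integrableOn_rpow_mul_exp_neg_mul_rpow (p := β) (s := k) (b := 1 / 2)
      (by have : (0 : ℝ) ≤ k := by positivity
          linarith) hβ (by norm_num)).congr_fun (fun u hu => ?_)
      measurableSet_Ioi
    simp only [abs_of_pos (Set.mem_Ioi.1 hu), Real.rpow_natCast]
    ring_nf
  rw [← integrableOn_univ, ← Set.Iic_union_Ioi (a := (0 : ℝ)), integrableOn_union,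
    integrableOn_Iic_iff_integrableOn_Iio]
  refine ⟨?_, h⟩
  have := h.comp_neg
  simpa using this

/-! ### The stable density as a Gaussian mixture -/

namespace IsStableMixing

variable {β : ℝ} {m : Measure ℝ≥0}

lemma integrable_prod (hm : IsStableMixing β m) {f : ℝ → ℝ} (hf : Measurable f)
    (hfi : Integrable (fun u => |f u| * Real.exp (-(|u| ^ β) / 2))) :
    Integrable (fun p : ℝ × ℝ≥0 => f p.1 * Real.exp (-(p.2 * p.1 ^ 2 / 2)))
      (volume.prod m) := by
  have := hm.prob
  rw [integrable_prod_iff (Measurable.aestronglyMeasurable (by fun_prop))]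
  refine ⟨ae_of_all _ fun u => ?_, ?_⟩
  · refine Integrable.const_mul (f := fun s : ℝ≥0 => Real.exp (-(s * u ^ 2 / 2))) ?_ (f u)
    convert integrable_exp_neg_mul m (l := u ^ 2 / 2) (by positivity) using 3
    ring
  · refine hfi.congr (ae_of_all _ fun u => ?_)
    simp only [norm_mul, Real.norm_eq_abs, Real.abs_exp]
    rw [integral_const_mul, hm.integral_exp]

/-- The mixing law has a finite moment of order `-1`. -/
lemma integrable_inv (hm : IsStableMixing β m) (hβ : 0 < β) :
    Integrable (fun s : ℝ≥0 => (s : ℝ)⁻¹) m := by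
  have := hm.prob
  have h := (hm.integrable_prod (f := fun u => |u|) (by fun_prop)
    (by simpa using integrable_abs_pow_mul_exp hβ 1)).integral_prod_right
  refine (h.const_mul (1 / 2)).congr ?_
  filter_upwards [hm.pos] with s hs
  rw [integral_abs_mul_exp hs]
  ring

theorem stableDensity_eq (hm : IsStableMixing β m) (hβ : 0 < β) (w : ℝ) :
    stableDensity β w = ∫ s, gaussianPDFReal 0 s w ∂m := by
  have := hm.prob
  have hint := hm.integrable_prod (f := fun u => Real.cos (u * w)) (by fun_prop) (by
    have h0 := integrable_abs_pow_mul_exp hβ 0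
    simp only [pow_zero, one_mul] at h0
    refine h0.bdd_mul (c := 1) (Measurable.aestronglyMeasurable (by fun_prop))
      (ae_of_all _ fun u => ?_)
    simpa using Real.abs_cos_le_one (u * w))
  have hswap := integral_integral_swap
    (f := fun (u : ℝ) (s : ℝ≥0) => Real.cos (u * w) * Real.exp (-(s * u ^ 2 / 2))) hint
  simp_rw [integral_const_mul, hm.integral_exp] at hswap
  unfold stableDensity
  rw [hswap, ← integral_const_mul]
  refine integral_congr_ae ?_
  filter_upwards [hm.pos] with s hs
  rw [integral_cos_mul_exp hs]
  have := Real.pi_pos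
  field_simp

lemma integrable_gaussianPDFReal (hm : IsStableMixing β m) (hβ : 0 < β) (w : ℝ) :
    Integrable (fun s => gaussianPDFReal 0 s w) m := by
  have := hm.prob
  refine ((integrable_const 1).add (hm.integrable_inv hβ)).mono'
    (measurable_gaussianPDFReal_variance w).aestronglyMeasurable ?_
  filter_upwards [hm.pos] with s hs
  rw [Real.norm_of_nonneg (gaussianPDFReal_nonneg _ _ _)]
  exact gaussianPDFReal_le_one_add_inv hs w

lemma measurable_deriv_gaussianPDFReal (w : ℝ) :
    Measurable (fun s : ℝ≥0 => -(w / s) * gaussianPDFReal 0 s w) := by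
  have := measurable_gaussianPDFReal_variance w
  fun_prop

lemma hasDerivAt_stableDensity (hm : IsStableMixing β m) (hβ : 0 < β) (w : ℝ) :
    Integrable (fun s : ℝ≥0 => -(w / s) * gaussianPDFReal 0 s w) m ∧
      HasDerivAt (stableDensity β) (∫ s : ℝ≥0, -(w / s) * gaussianPDFReal 0 s w ∂m) w := by
  have h := hasDerivAt_integral_of_dominated_loc_of_deriv_le (μ := m) (𝕜 := ℝ) (x₀ := w)
    (F := fun w s => gaussianPDFReal 0 s w)
    (F' := fun w (s : ℝ≥0) => -(w / s) * gaussianPDFReal 0 s w)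
    (bound := fun s => (s : ℝ)⁻¹) univ_mem
    (Eventually.of_forall fun x => (measurable_gaussianPDFReal_variance x).aestronglyMeasurable)
    (hm.integrable_gaussianPDFReal hβ w)
    (measurable_deriv_gaussianPDFReal w).aestronglyMeasurable
    (by filter_upwards [hm.pos] with s hs x _ using abs_deriv_gaussianPDFReal_le hs x)
    (hm.integrable_inv hβ)
    (ae_of_all _ fun s x _ => hasDerivAt_gaussianPDFReal s x)
  have h1 : stableDensity β = fun w => ∫ s, gaussianPDFReal 0 s w ∂m :=
    funext fun w => hm.stableDensity_eq hβ w
  rw [h1]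
  exact h

lemma deriv_stableDensity (hm : IsStableMixing β m) (hβ : 0 < β) (w : ℝ) :
    deriv (stableDensity β) w = ∫ s : ℝ≥0, -(w / s) * gaussianPDFReal 0 s w ∂m :=
  (hm.hasDerivAt_stableDensity hβ w).2.deriv

lemma stableDensity_pos (hm : IsStableMixing β m) (hβ : 0 < β) (w : ℝ) :
    0 < stableDensity β w := by
  have := hm.prob
  rw [hm.stableDensity_eq hβ, integral_pos_iff_support_of_nonneg_ae
    (ae_of_all _ fun s => gaussianPDFReal_nonneg _ _ _) (hm.integrable_gaussianPDFReal hβ w)]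
  have : m (Function.support fun s => gaussianPDFReal 0 s w) = 1 := by
    rw [prob_compl_eq_zero_iff (measurableSet_support (measurable_gaussianPDFReal_variance w))
      |>.symm]
    rw [← mem_ae_iff]
    filter_upwards [hm.pos] with s hs
    exact (gaussianPDFReal_pos 0 s w hs.ne').ne'
  rw [this]; exact one_pos

lemma stableDensity_le (hm : IsStableMixing β m) (hβ : 0 < β) (w : ℝ) :
    stableDensity β w ≤ 1 + ∫ s : ℝ≥0, (s : ℝ)⁻¹ ∂m := by
  have := hm.prob
  rw [hm.stableDensity_eq hβ]
  calc _ ≤ ∫ s : ℝ≥0, (1 + (s : ℝ)⁻¹) ∂m := by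
        refine integral_mono_ae (hm.integrable_gaussianPDFReal hβ w)
          ((integrable_const _).add (hm.integrable_inv hβ)) ?_
        filter_upwards [hm.pos] with s hs using gaussianPDFReal_le_one_add_inv hs w
    _ = _ := by
      rw [integral_add (integrable_const _) (hm.integrable_inv hβ)]; simp

lemma abs_deriv_stableDensity_le (hm : IsStableMixing β m) (hβ : 0 < β) (w : ℝ) :
    |deriv (stableDensity β) w| ≤ ∫ s : ℝ≥0, (s : ℝ)⁻¹ ∂m := by
  rw [hm.deriv_stableDensity hβ]
  refine (abs_integral_le_integral_abs).trans ?_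
  refine integral_mono_ae (hm.hasDerivAt_stableDensity hβ w).1.abs (hm.integrable_inv hβ) ?_
  filter_upwards [hm.pos] with s hs using abs_deriv_gaussianPDFReal_le hs w

/-- The derivative of the density is controlled by the density itself, at a smaller argument. -/
lemma abs_mul_deriv_stableDensity_le (hm : IsStableMixing β m) (hβ : 0 < β) (w : ℝ) :
    |w * deriv (stableDensity β) w| ≤ 4 * stableDensity β (w / √2) := by
  rw [hm.deriv_stableDensity hβ, hm.stableDensity_eq hβ, ← integral_const_mul,
    ← integral_const_mul]
  refine (abs_integral_le_integral_abs).trans ?_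
  refine integral_mono ((hm.hasDerivAt_stableDensity hβ w).1.const_mul w).abs
    ((hm.integrable_gaussianPDFReal hβ _).const_mul _) fun s => ?_
  have h := sq_div_mul_gaussianPDFReal_le (s := s) w
  have h2 : w * (-(w / s) * gaussianPDFReal 0 s w) = -(w ^ 2 / s * gaussianPDFReal 0 s w) := by
    ring
  simp only
  rw [h2, abs_neg, abs_of_nonneg (mul_nonneg (by positivity) (gaussianPDFReal_nonneg _ _ _))]
  exact h

lemma stableDensity_le_of_abs_le (hm : IsStableMixing β m) (hβ : 0 < β) {x y : ℝ}
    (h : |x| ≤ |y|) : stableDensity β y ≤ stableDensity β x := by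
  rw [hm.stableDensity_eq hβ, hm.stableDensity_eq hβ]
  exact integral_mono (hm.integrable_gaussianPDFReal hβ _) (hm.integrable_gaussianPDFReal hβ _)
    fun s => gaussianPDFReal_le_of_abs_le h

lemma differentiable_stableDensity (hm : IsStableMixing β m) (hβ : 0 < β) :
    Differentiable ℝ (stableDensity β) :=
  fun w => (hm.hasDerivAt_stableDensity hβ w).2.differentiableAt

/-! ### The stable density is a density -/

lemma integrable_gaussianPDFReal_prod (hm : IsStableMixing β m) :
    Integrable (fun p : ℝ≥0 × ℝ => gaussianPDFReal 0 p.1 p.2) (m.prod volume) := by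
  have := hm.prob
  rw [integrable_prod_iff measurable_gaussianPDFReal_uncurry.aestronglyMeasurable]
  refine ⟨ae_of_all _ fun s => ProbabilityTheory.integrable_gaussianPDFReal 0 s, ?_⟩
  refine (integrable_const 1).congr ?_
  filter_upwards [hm.pos] with s hs
  simp_rw [Real.norm_of_nonneg (gaussianPDFReal_nonneg 0 s _)]
  rw [integral_gaussianPDFReal_eq_one 0 hs.ne']

lemma integrable_stableDensity (hm : IsStableMixing β m) (hβ : 0 < β) :
    Integrable (stableDensity β) := by
  have := hm.prob
  refine hm.integrable_gaussianPDFReal_prod.integral_prod_right.congr (ae_of_all _ fun w => ?_)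
  exact (hm.stableDensity_eq hβ w).symm

lemma charFun_withDensity_stableDensity (hm : IsStableMixing β m) (hβ : 0 < β) (u : ℝ) :
    charFun (volume.withDensity fun x => ENNReal.ofReal (stableDensity β x)) u =
      ((Real.exp (-(|u| ^ β) / 2) : ℝ) : ℂ) := by
  have := hm.prob
  have hmeas : Measurable (stableDensity β) :=
    (hm.differentiable_stableDensity hβ).continuous.measurable
  rw [charFun_apply_real, integral_withDensity_eq_integral_toReal_smul (by fun_prop) (by simp)]
  have h1 : ∀ x : ℝ, (ENNReal.ofReal (stableDensity β x)).toReal •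
      Complex.exp (u * x * Complex.I) =
      ∫ s, gaussianPDFReal 0 s x • Complex.exp (u * x * Complex.I) ∂m := by
    intro x
    rw [ENNReal.toReal_ofReal (hm.stableDensity_pos hβ x).le, integral_smul_const,
      hm.stableDensity_eq hβ]
  simp_rw [h1]
  have hint : Integrable (Function.uncurry fun (s : ℝ≥0) (x : ℝ) =>
      gaussianPDFReal 0 s x • Complex.exp (u * x * Complex.I)) (m.prod volume) := by
    refine hm.integrable_gaussianPDFReal_prod.mono ?_ (ae_of_all _ fun p => ?_)
    · refine Measurable.aestronglyMeasurable ?_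
      have := measurable_gaussianPDFReal_uncurry
      unfold Function.uncurry
      fun_prop
    · simp only [Function.uncurry, norm_smul]
      rw [show (u : ℂ) * p.2 * Complex.I = ((u * p.2 : ℝ) : ℂ) * Complex.I by push_cast; ring,
        Complex.norm_exp_ofReal_mul_I, mul_one]
  rw [← integral_integral_swap hint, ← hm.integral_exp u, ← integral_complex_ofReal]
  refine integral_congr_ae ?_
  filter_upwards [hm.pos] with s hs
  rw [← integral_gaussianReal_eq_integral_smul hs.ne', ← charFun_apply_real, charFun_gaussianReal]
  push_cast
  congr 1
  ring

lemma isProbabilityMeasure_withDensity (hm : IsStableMixing β m) (hβ : 0 < β) :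
    IsProbabilityMeasure (volume.withDensity fun x => ENNReal.ofReal (stableDensity β x)) := by
  have := hm.prob
  have h := integral_integral_swap (f := fun (s : ℝ≥0) (x : ℝ) => gaussianPDFReal 0 s x)
    hm.integrable_gaussianPDFReal_prod
  have h1 : ∫ s, (∫ x, gaussianPDFReal 0 s x) ∂m = 1 := by
    rw [integral_congr_ae (g := fun _ => (1 : ℝ))]
    · simp
    · filter_upwards [hm.pos] with s hs using integral_gaussianPDFReal_eq_one 0 hs.ne'
  constructor
  rw [withDensity_apply _ MeasurableSet.univ, Measure.restrict_univ,
    ← ofReal_integral_eq_lintegral_ofReal (hm.integrable_stableDensity hβ)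
      (ae_of_all _ fun x => (hm.stableDensity_pos hβ x).le)]
  simp_rw [hm.stableDensity_eq hβ]
  rw [← h, h1, ENNReal.ofReal_one]

theorem isContinuousDensity (hm : IsStableMixing β m) (hβ : 0 < β) {μ : Measure ℝ}
    [IsFiniteMeasure μ]
    (h : ∀ u, charFun μ u = ((Real.exp (-(|u| ^ β) / 2) : ℝ) : ℂ)) :
    IsContinuousDensity μ (stableDensity β) where
  continuous := (hm.differentiable_stableDensity hβ).continuous
  nonneg x := (hm.stableDensity_pos hβ x).le
  eq_withDensity := by
    have := hm.isProbabilityMeasure_withDensity hβ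
    refine Measure.ext_of_charFun (funext fun u => ?_)
    rw [h, hm.charFun_withDensity_stableDensity hβ]

/-! ### Tails -/

lemma stableDensity_le_rpow (hm : IsStableMixing β m) (hβ : 0 < β) {x : ℝ} (hx : 0 < x) :
    stableDensity β x ≤ 2 / x * (4 / x) ^ β := by
  have := hm.isProbabilityMeasure_withDensity hβ
  set μ : Measure ℝ := volume.withDensity fun x => ENNReal.ofReal (stableDensity β x)
  have hx2 : 0 < x / 2 := by positivity
  -- unimodality: the density at `x` is at most its mean over `[x / 2, x]`
  have h1 : x / 2 * stableDensity β x ≤ μ.real {w | x / 2 < |w|} := by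
    have h2 : ENNReal.ofReal (x / 2 * stableDensity β x) ≤ μ {w | x / 2 < |w|} := by
      calc ENNReal.ofReal (x / 2 * stableDensity β x)
          = ∫⁻ _ in Set.Ioc (x / 2) x, ENNReal.ofReal (stableDensity β x) := by
            rw [setLIntegral_const, Real.volume_Ioc, ENNReal.ofReal_mul hx2.le, mul_comm]
            congr 2; ring
        _ ≤ ∫⁻ w in Set.Ioc (x / 2) x, ENNReal.ofReal (stableDensity β w) := by
            refine setLIntegral_mono' measurableSet_Ioc fun w hw => ?_
            refine ENNReal.ofReal_le_ofReal (hm.stableDensity_le_of_abs_le hβ ?_)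
            rw [abs_of_pos hx, abs_of_pos (hx2.trans hw.1)]; exact hw.2
        _ = μ (Set.Ioc (x / 2) x) := (withDensity_apply _ measurableSet_Ioc).symm
        _ ≤ _ := measure_mono fun w hw => hw.1.trans_le (le_abs_self w)
    have := ENNReal.toReal_mono (measure_ne_top _ _) h2
    rwa [ENNReal.toReal_ofReal (mul_nonneg hx2.le (hm.stableDensity_pos hβ x).le)] at this
  have h3 := measureReal_abs_gt_le_integral_charFun (μ := μ) hx2
  have h4 : ‖∫ t in (-2 * (x / 2)⁻¹)..(2 * (x / 2)⁻¹), 1 - charFun μ t‖ ≤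
      (4 / x) ^ β / 2 * |2 * (x / 2)⁻¹ - -2 * (x / 2)⁻¹| := by
    refine intervalIntegral.norm_integral_le_of_norm_le_const fun t ht => ?_
    have ht' : |t| ≤ 4 / x := by
      have h5 : 2 * (x / 2)⁻¹ = 4 / x := by field_simp; norm_num
      rw [Set.uIoc_of_le (by rw [neg_mul, h5]; have : 0 < 4 / x := by positivity
                             linarith), neg_mul, h5] at ht
      exact abs_le.2 ⟨ht.1.le, ht.2⟩
    rw [hm.charFun_withDensity_stableDensity hβ, ← Complex.ofReal_one, ← Complex.ofReal_sub,
      Complex.norm_real, Real.norm_eq_abs]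
    have h6 : |t| ^ β ≤ (4 / x) ^ β := Real.rpow_le_rpow (abs_nonneg t) ht' hβ.le
    have h7 := Real.add_one_le_exp (-(|t| ^ β) / 2)
    have h8 : Real.exp (-(|t| ^ β) / 2) ≤ 1 := Real.exp_le_one_iff.2 (by
      have := Real.rpow_nonneg (abs_nonneg t) β
      linarith)
    rw [abs_of_nonneg (by linarith)]
    linarith
  have h9 : |2 * (x / 2)⁻¹ - -2 * (x / 2)⁻¹| = 8 / x := by
    rw [abs_of_nonneg]
    · field_simp; norm_num
    · have : 0 < (x / 2)⁻¹ := by positivity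
      linarith
  rw [h9] at h4
  have h10 : x / 2 * stableDensity β x ≤ (4 / x) ^ β :=
    calc _ ≤ _ := h1
      _ ≤ _ := h3
      _ ≤ 2⁻¹ * (x / 2) * ((4 / x) ^ β / 2 * (8 / x)) := by gcongr
      _ = _ := by field_simp; norm_num
  calc stableDensity β x = 2 / x * (x / 2 * stableDensity β x) := by field_simp
    _ ≤ _ := by gcongr

lemma tendsto_rpow_mul_stableDensity (hm : IsStableMixing β m) (hβ : 0 < β) :
    Tendsto (fun x => x ^ β * stableDensity β x) atTop (𝓝 0) := by
  have h1 : Tendsto (fun x : ℝ => 2 * 4 ^ β / x) atTop (𝓝 0) :=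
    tendsto_const_nhds.div_atTop tendsto_id
  refine squeeze_zero' ?_ ?_ h1
  · filter_upwards [eventually_gt_atTop 0] with x hx
    exact mul_nonneg (Real.rpow_nonneg hx.le _) (hm.stableDensity_pos hβ x).le
  · filter_upwards [eventually_gt_atTop 0] with x hx
    have h2 : 0 < x ^ β := Real.rpow_pos_of_pos hx _
    calc _ ≤ x ^ β * (2 / x * (4 / x) ^ β) := by gcongr; exact hm.stableDensity_le_rpow hβ hx
      _ = _ := by
        rw [Real.div_rpow (by norm_num) hx.le]
        field_simp

/-! ### Finiteness of the scale and translation information -/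

lemma scaleIntegrand_nonneg (hm : IsStableMixing β m) (hβ : 0 < β) (w : ℝ) :
    0 ≤ scaleIntegrand β w :=
  div_nonneg (sq_nonneg _) (hm.stableDensity_pos hβ w).le

lemma translationIntegrand_nonneg (hm : IsStableMixing β m) (hβ : 0 < β) (w : ℝ) :
    0 ≤ translationIntegrand β w :=
  div_nonneg (sq_nonneg _) (hm.stableDensity_pos hβ w).le

lemma measurable_stableDensity (hm : IsStableMixing β m) (hβ : 0 < β) :
    Measurable (stableDensity β) :=
  (hm.differentiable_stableDensity hβ).continuous.measurable

lemma integrable_comp_div_sqrt_two (hm : IsStableMixing β m) (hβ : 0 < β) :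
    Integrable (fun w => stableDensity β (w / √2)) :=
  (hm.integrable_stableDensity hβ).comp_div (by positivity)

theorem integrable_scaleIntegrand (hm : IsStableMixing β m) (hβ : 0 < β) :
    Integrable (scaleIntegrand β) := by
  have hmeas := hm.measurable_stableDensity hβ
  refine ((hm.integrable_comp_div_sqrt_two hβ).const_mul 32).mono'
    (Measurable.aestronglyMeasurable (by unfold scaleIntegrand; fun_prop))
    (ae_of_all _ fun w => ?_)
  rw [Real.norm_of_nonneg (hm.scaleIntegrand_nonneg hβ w)]
  unfold scaleIntegrand
  have hpos := hm.stableDensity_pos hβ w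
  have hi := hm.integrable_gaussianPDFReal hβ w
  have hd := (hm.hasDerivAt_stableDensity hβ w).1
  have hi2 := (hm.integrable_gaussianPDFReal hβ (w / √2)).const_mul 32
  have ha : Integrable (fun s : ℝ≥0 =>
      gaussianPDFReal 0 s w + w * (-(w / s) * gaussianPDFReal 0 s w)) m :=
    hi.add (hd.const_mul w)
  have heq : stableDensity β w + w * deriv (stableDensity β) w =
      ∫ s : ℝ≥0, (gaussianPDFReal 0 s w + w * (-(w / s) * gaussianPDFReal 0 s w)) ∂m := by
    rw [integral_add hi (hd.const_mul w), integral_const_mul, ← hm.deriv_stableDensity hβ,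
      ← hm.stableDensity_eq hβ]
  have hle : ∀ᵐ s ∂m, (gaussianPDFReal 0 s w + w * (-(w / s) * gaussianPDFReal 0 s w)) ^ 2 /
      gaussianPDFReal 0 s w ≤ 32 * gaussianPDFReal 0 s (w / √2) := by
    filter_upwards [hm.pos] with s hs
    have hg := gaussianPDFReal_pos 0 s w hs.ne'
    refine le_of_eq_of_le ?_ (one_sub_sq_mul_gaussianPDFReal_le (s := s) w)
    field_simp
    ring
  have hq : Integrable (fun s : ℝ≥0 =>
      (gaussianPDFReal 0 s w + w * (-(w / s) * gaussianPDFReal 0 s w)) ^ 2 /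
      gaussianPDFReal 0 s w) m := by
    refine hi2.mono' ((ha.aemeasurable.pow_const 2).div hi.aemeasurable).aestronglyMeasurable ?_
    filter_upwards [hle] with s hs
    rwa [Real.norm_of_nonneg (div_nonneg (sq_nonneg _) (gaussianPDFReal_nonneg _ _ _))]
  have hcs := sq_integral_le (μ := m)
    (by filter_upwards [hm.pos] with s hs using gaussianPDFReal_pos 0 s w hs.ne') ha hi hq
  rw [← heq, ← hm.stableDensity_eq hβ] at hcs
  rw [div_le_iff₀' hpos]
  refine hcs.trans ?_
  gcongr
  rw [hm.stableDensity_eq hβ, ← integral_const_mul]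
  exact integral_mono_ae hq hi2 hle

theorem integrable_translationIntegrand (hm : IsStableMixing β m) (hβ : 0 < β) :
    Integrable (translationIntegrand β) := by
  have := hm.prob
  have hmeas := hm.measurable_stableDensity hβ
  have hprod : Integrable (fun p : ℝ≥0 × ℝ =>
      4 * ((p.1 : ℝ)⁻¹ * gaussianPDFReal 0 p.1 (p.2 / √2))) (m.prod volume) := by
    refine Integrable.const_mul ?_ _
    rw [integrable_prod_iff]
    · refine ⟨ae_of_all _ fun s => ?_, ?_⟩
      · exact ((ProbabilityTheory.integrable_gaussianPDFReal 0 s).comp_div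
          (R := √2) (by positivity)).const_mul (s : ℝ)⁻¹
      · refine ((hm.integrable_inv hβ).mul_const √2).congr ?_
        filter_upwards [hm.pos] with s hs
        have h1 : ∀ y : ℝ, ‖(s : ℝ)⁻¹ * gaussianPDFReal 0 s (y / √2)‖ =
            (s : ℝ)⁻¹ * gaussianPDFReal 0 s (y / √2) := fun y =>
          Real.norm_of_nonneg (mul_nonneg (by positivity) (gaussianPDFReal_nonneg _ _ _))
        simp_rw [h1]
        rw [integral_const_mul, Measure.integral_comp_div, integral_gaussianPDFReal_eq_one 0 hs.ne',
          smul_eq_mul, mul_one, abs_of_nonneg (Real.sqrt_nonneg 2)]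
    · refine Measurable.aestronglyMeasurable ?_
      have := measurable_gaussianPDFReal_uncurry.comp
        (f := fun p : ℝ≥0 × ℝ => (p.1, p.2 / √2)) (by fun_prop)
      simp only [Function.comp_def] at this
      fun_prop
  refine hprod.integral_prod_right.mono'
    (Measurable.aestronglyMeasurable (by unfold translationIntegrand; fun_prop)) ?_
  filter_upwards [hprod.prod_left_ae] with w hi2
  rw [Real.norm_of_nonneg (hm.translationIntegrand_nonneg hβ w)]
  unfold translationIntegrand
  have hpos := hm.stableDensity_pos hβ w
  have hi := hm.integrable_gaussianPDFReal hβ w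
  have hd := (hm.hasDerivAt_stableDensity hβ w).1
  have hle : ∀ᵐ s : ℝ≥0 ∂m, (-(w / s) * gaussianPDFReal 0 s w) ^ 2 / gaussianPDFReal 0 s w ≤
      4 * ((s : ℝ)⁻¹ * gaussianPDFReal 0 s (w / √2)) := by
    filter_upwards [hm.pos] with s hs
    have hg := gaussianPDFReal_pos 0 s w hs.ne'
    have hs' : (0 : ℝ) < s := hs
    have h := mul_le_mul_of_nonneg_left (sq_div_mul_gaussianPDFReal_le (s := s) w)
      (inv_pos.2 hs').le
    refine le_trans (le_of_eq ?_) (h.trans (le_of_eq ?_))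
    · field_simp
    · ring
  have hq : Integrable (fun s : ℝ≥0 =>
      (-(w / s) * gaussianPDFReal 0 s w) ^ 2 / gaussianPDFReal 0 s w) m := by
    refine hi2.mono' ((hd.aemeasurable.pow_const 2).div hi.aemeasurable).aestronglyMeasurable ?_
    filter_upwards [hle] with s hs
    rwa [Real.norm_of_nonneg (div_nonneg (sq_nonneg _) (gaussianPDFReal_nonneg _ _ _))]
  have hcs := sq_integral_le (μ := m)
    (by filter_upwards [hm.pos] with s hs using gaussianPDFReal_pos 0 s w hs.ne') hd hi hq
  rw [← hm.deriv_stableDensity hβ, ← hm.stableDensity_eq hβ] at hcs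
  rw [div_le_iff₀' hpos]
  refine hcs.trans ?_
  exact mul_le_mul_of_nonneg_left (integral_mono_ae hq hi2 hle) hpos.le

end IsStableMixing

/-! ### Poisson moments -/

lemma poisson_weight_succ (r : ℝ≥0) (n : ℕ) :
    Real.exp (-r) * (r : ℝ) ^ (n + 1) / (n + 1).factorial * ((n + 1 : ℕ) : ℝ) =
      r * (Real.exp (-r) * (r : ℝ) ^ n / n.factorial) := by
  rw [Nat.factorial_succ]
  have : (n.factorial : ℝ) ≠ 0 := by positivity
  have : ((n + 1 : ℕ) : ℝ) ≠ 0 := by positivity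
  push_cast
  field_simp
  ring

lemma hasSum_poisson_mul_natCast (r : ℝ≥0) :
    HasSum (fun n : ℕ => Real.exp (-r) * (r : ℝ) ^ n / n.factorial * (n : ℝ)) r := by
  rw [← hasSum_nat_add_iff' 1]
  have h := (hasSum_one_poissonMeasure r).mul_left (r : ℝ)
  simp_rw [poisson_weight_succ]
  simpa using h

lemma hasSum_poisson_mul_descFactorial (r : ℝ≥0) :
    HasSum (fun n : ℕ => Real.exp (-r) * (r : ℝ) ^ n / n.factorial * ((n : ℝ) * (n - 1)))
      ((r : ℝ) ^ 2) := by
  rw [← hasSum_nat_add_iff' 1]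
  have h := (hasSum_poisson_mul_natCast r).mul_left (r : ℝ)
  have h1 : (fun n : ℕ => Real.exp (-r) * (r : ℝ) ^ (n + 1) / (n + 1).factorial *
      (((n + 1 : ℕ) : ℝ) * (((n + 1 : ℕ) : ℝ) - 1))) =
      fun n : ℕ => r * (Real.exp (-r) * (r : ℝ) ^ n / n.factorial * (n : ℝ)) := by
    ext n
    rw [← mul_assoc, poisson_weight_succ]
    push_cast; ring
  rw [h1]
  simpa [sq] using h

lemma natCast_mul_sub_one_nonneg (n : ℕ) : 0 ≤ (n : ℝ) * (n - 1) := by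
  rcases n with _ | n
  · simp
  · push_cast; rw [add_sub_cancel_right]; positivity

lemma integrable_poisson_natCast (r : ℝ≥0) :
    Integrable (fun n : ℕ => (n : ℝ)) (poissonMeasure r) := by
  rw [integrable_poissonMeasure_iff]
  simpa using (hasSum_poisson_mul_natCast r).summable

lemma integrable_poisson_descFactorial (r : ℝ≥0) :
    Integrable (fun n : ℕ => (n : ℝ) * (n - 1)) (poissonMeasure r) := by
  rw [integrable_poissonMeasure_iff]
  simp_rw [Real.norm_of_nonneg (natCast_mul_sub_one_nonneg _)]
  exact (hasSum_poisson_mul_descFactorial r).summable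

lemma integral_poisson_natCast (r : ℝ≥0) : ∫ n : ℕ, (n : ℝ) ∂(poissonMeasure r) = r := by
  rw [integral_poissonMeasure]
  exact (hasSum_poisson_mul_natCast r).tsum_eq

lemma integral_poisson_descFactorial (r : ℝ≥0) :
    ∫ n : ℕ, (n : ℝ) * (n - 1) ∂(poissonMeasure r) = (r : ℝ) ^ 2 := by
  rw [integral_poissonMeasure]
  exact (hasSum_poisson_mul_descFactorial r).tsum_eq

lemma integrable_poisson_sq (r : ℝ≥0) :
    Integrable (fun n : ℕ => (n : ℝ) ^ 2) (poissonMeasure r) := by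
  refine ((integrable_poisson_descFactorial r).add (integrable_poisson_natCast r)).congr
    (ae_of_all _ fun n => ?_)
  simp only [Pi.add_apply]; ring

lemma integral_poisson_sq (r : ℝ≥0) :
    ∫ n : ℕ, (n : ℝ) ^ 2 ∂(poissonMeasure r) = (r : ℝ) ^ 2 + r := by
  have h := integral_add (integrable_poisson_descFactorial r) (integrable_poisson_natCast r)
  rw [integral_poisson_descFactorial, integral_poisson_natCast] at h
  rw [← h]
  congr 1; ext n; ring

/-- A Poisson integral differs from its first two terms by `O(r ^ 2)`. -/
lemma abs_integral_poisson_sub_le {r : ℝ≥0} {f : ℕ → ℝ} {C : ℝ} (hC : 0 ≤ C)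
    (hf : ∀ n, |f n| ≤ C * (1 + n)) :
    |∫ n, f n ∂(poissonMeasure r) - Real.exp (-r) * f 0 - Real.exp (-r) * r * f 1| ≤
      2 * C * (r : ℝ) ^ 2 := by
  have hfi : Integrable f (poissonMeasure r) := by
    refine (((integrable_const (1 : ℝ)).add (integrable_poisson_natCast r)).const_mul C).mono'
      (Measurable.aestronglyMeasurable (measurable_of_countable _)) (ae_of_all _ hf)
  have h1 := hasSum_integral_poissonMeasure hfi
  have h2 := (hasSum_nat_add_iff' 2).2 h1
  have h3 := (hasSum_nat_add_iff' 2).2 ((hasSum_poisson_mul_descFactorial r).mul_left (2 * C))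
  have h4 := h2.norm_le_of_bounded h3 fun n => ?_
  · simp [Finset.sum_range_succ] at h4
    rw [sub_sub]
    refine le_trans (le_of_eq ?_) (h4.trans (le_of_eq ?_))
    · congr 2
    · ring
  · rw [norm_smul, Real.norm_of_nonneg (by positivity), Real.norm_eq_abs, mul_left_comm]
    gcongr
    refine (hf _).trans ?_
    rw [mul_comm 2 C, mul_assoc]
    gcongr
    push_cast
    have : (0 : ℝ) ≤ n := by positivity
    nlinarith

/-! ### Laws and densities of scaled and convolved variables -/

lemma map_mul_left_withDensity {f : ℝ → ℝ} (hf : Measurable f) {r : ℝ} (hr : 0 < r) :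
    (volume.withDensity fun x => ENNReal.ofReal (f x)).map (fun x => r * x) =
      volume.withDensity fun x => ENNReal.ofReal (f (x / r) / r) := by
  ext A hA
  rw [Measure.map_apply (by fun_prop) hA,
    withDensity_apply _ (measurableSet_preimage (by fun_prop) hA), withDensity_apply _ hA]
  conv_rhs => rw [← Real.smul_map_volume_mul_left hr.ne', Measure.restrict_smul,
    lintegral_smul_measure]
  change _ = _ * ∫⁻ a in A, _ ∂(Measure.map (fun x => r * x) volume)
  rw [setLIntegral_map hA (by fun_prop) (by fun_prop), ← lintegral_const_mul _ (by fun_prop)]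
  refine lintegral_congr fun x => ?_
  rw [← ENNReal.ofReal_mul (abs_nonneg r), abs_of_pos hr, mul_div_cancel_left₀ _ hr.ne',
    mul_div_cancel₀ _ hr.ne']

lemma IsContinuousDensity.map_mul_left {μ : Measure ℝ} {f : ℝ → ℝ} (hf : IsContinuousDensity μ f)
    {r : ℝ} (hr : 0 < r) :
    IsContinuousDensity (μ.map fun x => r * x) (fun x => f (x / r) / r) where
  continuous := by have := hf.continuous; fun_prop
  nonneg x := div_nonneg (hf.nonneg _) hr.le
  eq_withDensity := by
    rw [← map_mul_left_withDensity hf.continuous.measurable hr]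
    exact congrArg _ hf.eq_withDensity

lemma conv_withDensity_eq {f : ℝ → ℝ} (hf : Measurable f) (h0 : ∀ x, 0 ≤ f x) {ν : Measure ℝ}
    [IsProbabilityMeasure ν] (hi : ∀ z, Integrable (fun y => f (z - y)) ν) :
    (volume.withDensity fun x => ENNReal.ofReal (f x)) ∗ ν =
      volume.withDensity fun z => ENNReal.ofReal (∫ y, f (z - y) ∂ν) := by
  ext A hA
  rw [← lintegral_indicator_one hA, Measure.lintegral_conv (measurable_one.indicator hA),
    withDensity_apply _ hA, ← lintegral_indicator hA,
    lintegral_withDensity_eq_lintegral_mul _ (by fun_prop)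
      (Measurable.lintegral_prod_right' (f := fun p : ℝ × ℝ => A.indicator 1 (p.1 + p.2))
        ((measurable_one.indicator hA).comp (by fun_prop)))]
  have hm : Measurable fun p : ℝ × ℝ => (A.indicator 1 (p.1 + p.2) : ℝ≥0∞) :=
    (measurable_one.indicator hA).comp (by fun_prop)
  simp only [Pi.mul_apply]
  calc ∫⁻ x, ENNReal.ofReal (f x) * ∫⁻ y, A.indicator 1 (x + y) ∂ν
      = ∫⁻ x, (∫⁻ y, ENNReal.ofReal (f x) * A.indicator 1 (x + y) ∂ν) := by
        refine lintegral_congr fun x => ?_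
        exact (lintegral_const_mul _ (hm.comp measurable_prodMk_left)).symm
    _ = ∫⁻ y, (∫⁻ x, ENNReal.ofReal (f x) * A.indicator 1 (x + y)) ∂ν :=
        lintegral_lintegral_swap (Measurable.aemeasurable (by
          unfold Function.uncurry
          exact (by fun_prop : Measurable fun p : ℝ × ℝ => ENNReal.ofReal (f p.1)).mul hm))
    _ = ∫⁻ y, (∫⁻ x, ENNReal.ofReal (f (x - y)) * A.indicator 1 x) ∂ν := by
        refine lintegral_congr fun y => ?_
        rw [← lintegral_sub_right_eq_self (fun x => ENNReal.ofReal (f x) * A.indicator 1 (x + y)) y]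
        simp
    _ = ∫⁻ x, (∫⁻ y, ENNReal.ofReal (f (x - y)) * A.indicator 1 x ∂ν) :=
        lintegral_lintegral_swap (Measurable.aemeasurable (by
          unfold Function.uncurry
          exact (by fun_prop : Measurable fun p : ℝ × ℝ => ENNReal.ofReal (f (p.2 - p.1))).mul
            ((measurable_one.indicator hA).comp measurable_snd)))
    _ = _ := by
        refine lintegral_congr fun x => ?_
        rw [lintegral_mul_const _ (by fun_prop),
          ← ofReal_integral_eq_lintegral_ofReal (hi x) (ae_of_all _ fun y => h0 _)]
        by_cases hx : x ∈ A <;> simp [hx]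

/-! ### The density of the stable law with Poisson noise -/

/-- The density of `c W + K`, where `W` has density `stableDensity β` and the independent variable
`K` is Poisson distributed with mean `Δ`. The scale `c` is kept free; for `c = Δ ^ (1 / β)` this is
the density of `W_Δ + Y_Δ`. -/
def noisyDensity (β c : ℝ) (Δ : ℝ≥0) (z : ℝ) : ℝ :=
  ∫ k : ℕ, stableDensity β ((z - k) / c) / c ∂(poissonMeasure Δ)

/-- `h(v) + v h'(v) + l h'(v)`. Up to sign this is the derivative at `s = 1` of the density of
`s (V + l)` at the point `v + l`, where `V` has density `h`. -/
def combinedScore (β l v : ℝ) : ℝ :=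
  stableDensity β v + v * deriv (stableDensity β) v + l * deriv (stableDensity β) v

namespace IsStableMixing

variable {β c : ℝ} {m : Measure ℝ≥0}

/-- A common bound for the density, its derivative and its scale derivative. -/
lemma exists_bound (hm : IsStableMixing β m) (hβ : 0 < β) :
    ∃ B : ℝ, 0 < B ∧ ∀ w, stableDensity β w ≤ B ∧ |deriv (stableDensity β) w| ≤ B ∧
      |stableDensity β w + w * deriv (stableDensity β) w| ≤ B := by
  set D := ∫ s : ℝ≥0, (s : ℝ)⁻¹ ∂m
  have hD : 0 ≤ D := integral_nonneg fun s => by positivity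
  refine ⟨5 * (1 + D), by positivity, fun w => ⟨?_, ?_, ?_⟩⟩
  · linarith [hm.stableDensity_le hβ w]
  · linarith [hm.abs_deriv_stableDensity_le hβ w]
  · have h1 := hm.stableDensity_le hβ w
    have h2 := hm.stableDensity_le hβ (w / √2)
    have h3 := hm.abs_mul_deriv_stableDensity_le hβ w
    have h4 := abs_add_le (stableDensity β w) (w * deriv (stableDensity β) w)
    rw [abs_of_pos (hm.stableDensity_pos hβ w)] at h4
    change _ ≤ 1 + D at h1
    change _ ≤ 1 + D at h2
    linarith

lemma integrable_noisy (hm : IsStableMixing β m) (hβ : 0 < β) (hc : 0 < c) (Δ : ℝ≥0) (z : ℝ) :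
    Integrable (fun k : ℕ => stableDensity β ((z - k) / c) / c) (poissonMeasure Δ) := by
  obtain ⟨B, -, hB⟩ := hm.exists_bound hβ
  refine Integrable.of_bound (C := B / c) (measurable_of_countable _).aestronglyMeasurable
    (ae_of_all _ fun k => ?_)
  rw [Real.norm_of_nonneg (div_nonneg (hm.stableDensity_pos hβ _).le hc.le)]
  gcongr
  exact (hB _).1

lemma noisyDensity_pos (hm : IsStableMixing β m) (hβ : 0 < β) (hc : 0 < c) (Δ : ℝ≥0) (z : ℝ) :
    0 < noisyDensity β c Δ z := by
  have h : ∀ k : ℕ, 0 < stableDensity β ((z - k) / c) / c :=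
    fun k => div_pos (hm.stableDensity_pos hβ _) hc
  unfold noisyDensity
  rw [integral_pos_iff_support_of_nonneg_ae (ae_of_all _ fun k => (h k).le)
    (hm.integrable_noisy hβ hc Δ z)]
  have : (Function.support fun k : ℕ => stableDensity β ((z - k) / c) / c) = Set.univ :=
    Set.eq_univ_of_forall fun k => (h k).ne'
  rw [this]; simp

lemma hasDerivAt_noisyDensity (hm : IsStableMixing β m) (hβ : 0 < β) (hc : 0 < c) (Δ : ℝ≥0)
    (z : ℝ) :
    Integrable (fun k : ℕ => deriv (stableDensity β) ((z - k) / c) / c / c) (poissonMeasure Δ) ∧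
      HasDerivAt (noisyDensity β c Δ)
        (∫ k : ℕ, deriv (stableDensity β) ((z - k) / c) / c / c ∂(poissonMeasure Δ)) z := by
  obtain ⟨B, -, hB⟩ := hm.exists_bound hβ
  refine hasDerivAt_integral_of_dominated_loc_of_deriv_le (μ := poissonMeasure Δ) (𝕜 := ℝ)
    (x₀ := z) (F := fun z (k : ℕ) => stableDensity β ((z - k) / c) / c)
    (F' := fun z (k : ℕ) => deriv (stableDensity β) ((z - k) / c) / c / c)
    (bound := fun _ => B / c / c) univ_mem
    (Eventually.of_forall fun x => (measurable_of_countable _).aestronglyMeasurable)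
    (hm.integrable_noisy hβ hc Δ z) (measurable_of_countable _).aestronglyMeasurable
    (ae_of_all _ fun k x _ => ?_) (integrable_const _) (ae_of_all _ fun k x _ => ?_)
  · rw [norm_div, norm_div, Real.norm_of_nonneg hc.le, Real.norm_eq_abs]
    gcongr
    exact (hB _).2.1
  · have h1 : HasDerivAt (fun x : ℝ => (x - k) / c) (1 / c) x :=
      ((hasDerivAt_id x).sub_const _).div_const _
    have h2 := (hm.differentiable_stableDensity hβ ((x - k) / c)).hasDerivAt.comp x h1
    refine (h2.div_const c).congr_deriv ?_
    ring

lemma abs_combinedScore_le {B : ℝ} (hB : ∀ w, stableDensity β w ≤ B ∧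
    |deriv (stableDensity β) w| ≤ B ∧ |stableDensity β w + w * deriv (stableDensity β) w| ≤ B)
    (l v : ℝ) : |combinedScore β l v| ≤ B * (1 + |l|) := by
  unfold combinedScore
  refine (abs_add_le _ _).trans ?_
  rw [abs_mul]
  have h1 := (hB v).2.2
  have h2 := mul_le_mul_of_nonneg_left (hB v).2.1 (abs_nonneg l)
  linarith

lemma noisyDensity_add_mul_deriv (hm : IsStableMixing β m) (hβ : 0 < β) (hc : 0 < c) (Δ : ℝ≥0)
    (z : ℝ) :
    noisyDensity β c Δ z + z * deriv (noisyDensity β c Δ) z =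
      ∫ k : ℕ, combinedScore β (k / c) ((z - k) / c) / c ∂(poissonMeasure Δ) := by
  obtain ⟨hi, hd⟩ := hm.hasDerivAt_noisyDensity hβ hc Δ z
  rw [hd.deriv, ← integral_const_mul, noisyDensity,
    ← integral_add (hm.integrable_noisy hβ hc Δ z) (hi.const_mul z)]
  congr 1
  ext k
  unfold combinedScore
  field_simp
  ring

lemma integrable_combinedScore (hm : IsStableMixing β m) (hβ : 0 < β) (hc : 0 < c) (Δ : ℝ≥0)
    (z : ℝ) :
    Integrable (fun k : ℕ => combinedScore β (k / c) ((z - k) / c) / c) (poissonMeasure Δ) := by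
  obtain ⟨B, -, hB⟩ := hm.exists_bound hβ
  refine ((((integrable_const (1 : ℝ)).add
    ((integrable_poisson_natCast Δ).div_const c)).const_mul B).div_const c).mono'
    (measurable_of_countable _).aestronglyMeasurable (ae_of_all _ fun k => ?_)
  rw [norm_div, Real.norm_of_nonneg hc.le, Real.norm_eq_abs]
  have := abs_combinedScore_le hB (k / c) ((z - k) / c)
  rw [abs_of_nonneg (by positivity : (0 : ℝ) ≤ k / c)] at this
  simp only [Pi.add_apply]
  gcongr

lemma continuous_noisyDensity (hm : IsStableMixing β m) (hβ : 0 < β) (hc : 0 < c) (Δ : ℝ≥0) :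
    Continuous (noisyDensity β c Δ) :=
  continuous_iff_continuousAt.2 fun z => (hm.hasDerivAt_noisyDensity hβ hc Δ z).2.continuousAt

/-- The law of `c W + K` has density `noisyDensity β c Δ`. -/
lemma isContinuousDensity_conv (hm : IsStableMixing β m) (hβ : 0 < β) (hc : 0 < c) (Δ : ℝ≥0) :
    IsContinuousDensity
      (((volume.withDensity fun x => ENNReal.ofReal (stableDensity β x)).map fun x => c * x) ∗
        (poissonMeasure Δ).map (Nat.cast : ℕ → ℝ)) (noisyDensity β c Δ) where
  continuous := hm.continuous_noisyDensity hβ hc Δ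
  nonneg z := (hm.noisyDensity_pos hβ hc Δ z).le
  eq_withDensity := by
    have hmeas := hm.measurable_stableDensity hβ
    have : IsProbabilityMeasure ((poissonMeasure Δ).map (Nat.cast : ℕ → ℝ)) :=
      Measure.isProbabilityMeasure_map .of_discrete
    have hi : ∀ z, Integrable (fun y => stableDensity β ((z - y) / c) / c)
        ((poissonMeasure Δ).map (Nat.cast : ℕ → ℝ)) := fun z => by
      rw [integrable_map_measure (Measurable.aestronglyMeasurable (by fun_prop)) .of_discrete]
      exact hm.integrable_noisy hβ hc Δ z
    rw [map_mul_left_withDensity hmeas hc, conv_withDensity_eq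
      (f := fun x => stableDensity β (x / c) / c) (by fun_prop)
      (fun x => div_nonneg (hm.stableDensity_pos hβ _).le hc.le) hi]
    congr 1
    ext z
    rw [integral_map .of_discrete (Measurable.aestronglyMeasurable (by fun_prop))]
    rfl

end IsStableMixing

/-! ### The Fisher information of the observation -/

lemma IsContinuousDensity.continuousDensity_eq {μ : Measure ℝ} [SFinite μ] {f : ℝ → ℝ}
    (hf : IsContinuousDensity μ f) : continuousDensity μ = f := by
  have h : ∃ f, IsContinuousDensity μ f := ⟨f, hf⟩
  rw [continuousDensity, dif_pos h]
  exact h.choose_spec.unique hf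

/-- `(q + z q')² / q` for the density `q` of `c W + K`. -/
def noisyIntegrand (β c : ℝ) (Δ : ℝ≥0) (z : ℝ) : ℝ :=
  (noisyDensity β c Δ z + z * deriv (noisyDensity β c Δ) z) ^ 2 / noisyDensity β c Δ z

section Observation

variable {Ω : Type*} [MeasurableSpace Ω] {P : Measure Ω} [IsProbabilityMeasure P]
  {β : ℝ} {m : Measure ℝ≥0} {W Y : ℝ≥0 → Ω → ℝ}

/-- Self-similarity: `W_Δ` has the law of `Δ ^ (1 / β) W_1`. -/
lemma map_stable_eq (hm : IsStableMixing β m) (hβ : 0 < β)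
    (hW : IsSymmetricStableProcess β W P) (Δ : ℝ≥0) :
    P.map (W Δ) = (volume.withDensity fun x => ENNReal.ofReal (stableDensity β x)).map
      fun x => ((Δ : ℝ) ^ (1 / β)) * x := by
  have := hm.isProbabilityMeasure_withDensity hβ
  have : IsProbabilityMeasure (P.map (W Δ)) :=
    Measure.isProbabilityMeasure_map (hW.measurable Δ).aemeasurable
  refine Measure.ext_of_charFun (funext fun u => ?_)
  rw [hW.charFun_eq, charFun_map_mul, hm.charFun_withDensity_stableDensity hβ, abs_mul,
    Real.mul_rpow (abs_nonneg _) (abs_nonneg _),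
    abs_of_nonneg (Real.rpow_nonneg Δ.coe_nonneg _), ← Real.rpow_mul Δ.coe_nonneg,
    one_div_mul_cancel hβ.ne',
    Real.rpow_one]

lemma isContinuousDensity_multiplicativeLaw (hm : IsStableMixing β m) (hβ : 0 < β)
    (hW : IsSymmetricStableProcess β W P) (hY : IsStandardPoissonProcess Y P)
    (hWY : IndepFun (fun ω t => W t ω) (fun ω t => Y t ω) P) {Δ : ℝ≥0} (hΔ : 0 < Δ) {r : ℝ}
    (hr : 0 < r) :
    IsContinuousDensity (multiplicativeLaw P W Y Δ r)
      (fun x => noisyDensity β ((Δ : ℝ) ^ (1 / β)) Δ (x / r) / r) := by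
  have hc : 0 < (Δ : ℝ) ^ (1 / β) := Real.rpow_pos_of_pos hΔ _
  have hind : IndepFun (W Δ) (Y Δ) P :=
    hWY.comp (measurable_pi_apply Δ) (measurable_pi_apply Δ)
  have h1 : multiplicativeLaw P W Y Δ r = (P.map (W Δ) ∗ P.map (Y Δ)).map fun x => r * x := by
    rw [← hind.map_add_eq_map_conv_map (hW.measurable Δ) (hY.measurable Δ),
      Measure.map_map (by fun_prop) ((hW.measurable Δ).add (hY.measurable Δ))]
    rfl
  rw [h1, map_stable_eq hm hβ hW, hY.law_eq]
  exact (hm.isContinuousDensity_conv hβ hc Δ).map_mul_left hr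

lemma continuousDensity_multiplicativeLaw (hm : IsStableMixing β m) (hβ : 0 < β)
    (hW : IsSymmetricStableProcess β W P) (hY : IsStandardPoissonProcess Y P)
    (hWY : IndepFun (fun ω t => W t ω) (fun ω t => Y t ω) P) {Δ : ℝ≥0} (hΔ : 0 < Δ) {r : ℝ}
    (hr : 0 < r) :
    continuousDensity (multiplicativeLaw P W Y Δ r) =
      fun x => noisyDensity β ((Δ : ℝ) ^ (1 / β)) Δ (x / r) / r := by
  have : SFinite (multiplicativeLaw P W Y Δ r) := by unfold multiplicativeLaw; infer_instance
  exact (isContinuousDensity_multiplicativeLaw hm hβ hW hY hWY hΔ hr).continuousDensity_eq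

lemma hasDerivAt_continuousDensity (hm : IsStableMixing β m) (hβ : 0 < β)
    (hW : IsSymmetricStableProcess β W P) (hY : IsStandardPoissonProcess Y P)
    (hWY : IndepFun (fun ω t => W t ω) (fun ω t => Y t ω) P) {Δ : ℝ≥0} (hΔ : 0 < Δ) {σ : ℝ}
    (hσ : 0 < σ) (x : ℝ) :
    HasDerivAt (fun r => continuousDensity (multiplicativeLaw P W Y Δ r) x)
      (-(noisyDensity β ((Δ : ℝ) ^ (1 / β)) Δ (x / σ) +
        x / σ * deriv (noisyDensity β ((Δ : ℝ) ^ (1 / β)) Δ) (x / σ)) / σ ^ 2) σ := by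
  have hc : 0 < (Δ : ℝ) ^ (1 / β) := Real.rpow_pos_of_pos hΔ _
  have h1 : HasDerivAt (fun r : ℝ => x / r) (-x / σ ^ 2) σ := by
    have := (hasDerivAt_inv hσ.ne').const_mul x
    refine this.congr_deriv ?_
    field_simp
  have h2 := (hm.hasDerivAt_noisyDensity hβ hc Δ (x / σ)).2.differentiableAt.hasDerivAt.comp σ h1
  have h3 := h2.div (hasDerivAt_id σ) hσ.ne'
  refine (h3.congr_deriv ?_).congr_of_eventuallyEq ?_
  · simp only [Function.comp, id]
    field_simp
    ring
  · filter_upwards [lt_mem_nhds hσ] with r hr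
    rw [continuousDensity_multiplicativeLaw hm hβ hW hY hWY hΔ hr]
    rfl

lemma fisherIntegrand_multiplicativeLaw (hm : IsStableMixing β m) (hβ : 0 < β)
    (hW : IsSymmetricStableProcess β W P) (hY : IsStandardPoissonProcess Y P)
    (hWY : IndepFun (fun ω t => W t ω) (fun ω t => Y t ω) P) {Δ : ℝ≥0} (hΔ : 0 < Δ) {σ : ℝ}
    (hσ : 0 < σ) :
    fisherIntegrand (multiplicativeLaw P W Y Δ) σ =
      fun x => (σ ^ 3)⁻¹ * noisyIntegrand β ((Δ : ℝ) ^ (1 / β)) Δ (x / σ) := by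
  have hc : 0 < (Δ : ℝ) ^ (1 / β) := Real.rpow_pos_of_pos hΔ _
  ext x
  have hq := hm.noisyDensity_pos hβ hc Δ (x / σ)
  rw [fisherIntegrand, (hasDerivAt_continuousDensity hm hβ hW hY hWY hΔ hσ x).deriv,
    continuousDensity_multiplicativeLaw hm hβ hW hY hWY hΔ hσ, noisyIntegrand]
  field_simp

/-- The Fisher information for `σ` is `σ⁻²` times the scale information of the density of
`W_Δ + Y_Δ`. -/
lemma fisherInformation_multiplicativeLaw (hm : IsStableMixing β m) (hβ : 0 < β)
    (hW : IsSymmetricStableProcess β W P) (hY : IsStandardPoissonProcess Y P)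
    (hWY : IndepFun (fun ω t => W t ω) (fun ω t => Y t ω) P) {Δ : ℝ≥0} (hΔ : 0 < Δ) {σ : ℝ}
    (hσ : 0 < σ) :
    fisherInformation (multiplicativeLaw P W Y Δ) σ =
      (∫ z, noisyIntegrand β ((Δ : ℝ) ^ (1 / β)) Δ z) / σ ^ 2 := by
  rw [fisherInformation, fisherIntegrand_multiplicativeLaw hm hβ hW hY hWY hΔ hσ,
    integral_const_mul, Measure.integral_comp_div, abs_of_pos hσ, smul_eq_mul]
  field_simp

lemma hasFiniteFisherInformation_of_integrable (hm : IsStableMixing β m) (hβ : 0 < β)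
    (hW : IsSymmetricStableProcess β W P) (hY : IsStandardPoissonProcess Y P)
    (hWY : IndepFun (fun ω t => W t ω) (fun ω t => Y t ω) P) {Δ : ℝ≥0} (hΔ : 0 < Δ) {σ : ℝ}
    (hσ : 0 < σ) (hi : Integrable (noisyIntegrand β ((Δ : ℝ) ^ (1 / β)) Δ)) :
    HasFiniteFisherInformation (multiplicativeLaw P W Y Δ) σ where
  density r hr := by
    rw [continuousDensity_multiplicativeLaw hm hβ hW hY hWY hΔ hr]
    exact isContinuousDensity_multiplicativeLaw hm hβ hW hY hWY hΔ hr
  pos x := by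
    rw [continuousDensity_multiplicativeLaw hm hβ hW hY hWY hΔ hσ]
    exact div_pos (hm.noisyDensity_pos hβ (Real.rpow_pos_of_pos hΔ _) Δ _) hσ
  differentiableAt x :=
    (hasDerivAt_continuousDensity hm hβ hW hY hWY hΔ hσ x).differentiableAt
  integrable := by
    rw [fisherIntegrand_multiplicativeLaw hm hβ hW hY hWY hΔ hσ]
    exact (hi.comp_div hσ.ne').const_mul _

end Observation

/-! ### The upper bound -/

/-- `(h + v h') h' / h`. Its integral is the off-diagonal entry of the Fisher information matrix of
the location-scale family of `h`; it vanishes by symmetry, but its finiteness suffices here. -/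
def crossIntegrand (β v : ℝ) : ℝ :=
  (stableDensity β v + v * deriv (stableDensity β) v) * deriv (stableDensity β) v /
    stableDensity β v

lemma integral_comp_sub_div_div (f : ℝ → ℝ) {c : ℝ} (hc : 0 < c) (a : ℝ) :
    ∫ z, f ((z - a) / c) / c = ∫ v, f v := by
  rw [integral_sub_right_eq_self (fun z => f (z / c) / c), integral_div,
    Measure.integral_comp_div, abs_of_pos hc, smul_eq_mul]
  field_simp

lemma _root_.MeasureTheory.Integrable.comp_sub_div_div {f : ℝ → ℝ} (hf : Integrable f) {c : ℝ}
    (hc : 0 < c) (a : ℝ) : Integrable fun z => f ((z - a) / c) / c :=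
  ((hf.comp_div hc.ne').comp_sub_right a).div_const c

namespace IsStableMixing

variable {β c : ℝ} {m : Measure ℝ≥0}

lemma sq_combinedScore_div (l v : ℝ) : combinedScore β l v ^ 2 / stableDensity β v =
    scaleIntegrand β v + 2 * l * crossIntegrand β v + l ^ 2 * translationIntegrand β v := by
  unfold combinedScore scaleIntegrand crossIntegrand translationIntegrand
  ring

lemma integrable_crossIntegrand (hm : IsStableMixing β m) (hβ : 0 < β) :
    Integrable (crossIntegrand β) := by
  have hmeas := hm.measurable_stableDensity hβ
  refine ((hm.integrable_scaleIntegrand hβ).add (hm.integrable_translationIntegrand hβ)).mono'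
    (Measurable.aestronglyMeasurable (by unfold crossIntegrand; fun_prop))
    (ae_of_all _ fun v => ?_)
  have hpos := hm.stableDensity_pos hβ v
  simp only [crossIntegrand, scaleIntegrand, translationIntegrand, Pi.add_apply, Real.norm_eq_abs]
  rw [abs_div, abs_of_pos hpos, ← add_div]
  gcongr
  rw [abs_le]
  constructor <;> nlinarith [sq_nonneg (stableDensity β v + v * deriv (stableDensity β) v +
    deriv (stableDensity β) v), sq_nonneg (stableDensity β v + v * deriv (stableDensity β) v -
    deriv (stableDensity β) v), sq_nonneg (stableDensity β v + v * deriv (stableDensity β) v),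
    sq_nonneg (deriv (stableDensity β) v)]

lemma integrable_sq_combinedScore_div (hm : IsStableMixing β m) (hβ : 0 < β) (l : ℝ) :
    Integrable fun v => combinedScore β l v ^ 2 / stableDensity β v := by
  simp_rw [sq_combinedScore_div]
  exact ((hm.integrable_scaleIntegrand hβ).add
    ((hm.integrable_crossIntegrand hβ).const_mul _)).add
    ((hm.integrable_translationIntegrand hβ).const_mul _)

lemma integral_sq_combinedScore_div (hm : IsStableMixing β m) (hβ : 0 < β) (l : ℝ) :
    ∫ v, combinedScore β l v ^ 2 / stableDensity β v =
      scaleInformation β + 2 * l * (∫ v, crossIntegrand β v) +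
        l ^ 2 * translationInformation β := by
  have h1 := hm.integrable_scaleIntegrand hβ
  have h2 := (hm.integrable_crossIntegrand hβ).const_mul (2 * l)
  have h3 := (hm.integrable_translationIntegrand hβ).const_mul (l ^ 2)
  have h12 : Integrable fun v => scaleIntegrand β v + 2 * l * crossIntegrand β v := h1.add h2
  simp_rw [sq_combinedScore_div]
  rw [integral_add h12 h3, integral_add h1 h2, integral_const_mul, integral_const_mul]
  rfl

lemma noisyIntegrand_nonneg (hm : IsStableMixing β m) (hβ : 0 < β) (hc : 0 < c) (Δ : ℝ≥0)
    (z : ℝ) : 0 ≤ noisyIntegrand β c Δ z :=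
  div_nonneg (sq_nonneg _) (hm.noisyDensity_pos hβ hc Δ z).le

lemma measurable_noisyIntegrand (hm : IsStableMixing β m) (hβ : 0 < β) (hc : 0 ≤ c) (Δ : ℝ≥0) :
    Measurable (noisyIntegrand β c Δ) := by
  have : Measurable (noisyDensity β c Δ) := by
    rcases hc.eq_or_lt with rfl | hc
    · have : noisyDensity β 0 Δ = fun _ => 0 := by ext z; simp [noisyDensity]
      rw [this]; fun_prop
    · exact (hm.continuous_noisyDensity hβ hc Δ).measurable
  unfold noisyIntegrand
  fun_prop

/-- Conditioning on the Poisson variable: the Fisher information of the mixture is finite, and at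
most the mean of the conditional informations. -/
theorem integrable_noisyIntegrand (hm : IsStableMixing β m) (hβ : 0 < β) (hc : 0 < c)
    (Δ : ℝ≥0) :
    Integrable (noisyIntegrand β c Δ) ∧
      ∫ z, noisyIntegrand β c Δ z ≤ scaleInformation β +
        2 * (Δ / c) * (∫ v, crossIntegrand β v) +
          ((Δ : ℝ) ^ 2 + Δ) / c ^ 2 * translationInformation β := by
  have hmeas := hm.measurable_stableDensity hβ
  let G : ℕ → ℝ → ℝ := fun k v => combinedScore β (k / c) v ^ 2 / stableDensity β v
  have hG0 : ∀ k v, 0 ≤ G k v := fun k v => div_nonneg (sq_nonneg _) (hm.stableDensity_pos hβ v).le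
  have hGi : ∀ k, Integrable (G k) := fun k => hm.integrable_sq_combinedScore_div hβ _
  have hGm : ∀ k, Measurable (G k) := fun k => by
    simp only [G]; unfold combinedScore; fun_prop
  have hint : ∀ k : ℕ, ∫ z, G k ((z - k) / c) / c = scaleInformation β +
      (2 / c * ∫ v, crossIntegrand β v) * k + translationInformation β / c ^ 2 * (k : ℝ) ^ 2 := by
    intro k
    rw [integral_comp_sub_div_div _ hc, hm.integral_sq_combinedScore_div hβ]
    ring
  have i1 := (integrable_poisson_natCast Δ).const_mul (2 / c * ∫ v, crossIntegrand β v)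
  have i2 := (integrable_poisson_sq Δ).const_mul (translationInformation β / c ^ 2)
  have i01 : Integrable (fun k : ℕ => scaleInformation β +
      (2 / c * ∫ v, crossIntegrand β v) * k) (poissonMeasure Δ) := (integrable_const _).add i1
  have hprod : Integrable (fun p : ℕ × ℝ => G p.1 ((p.2 - p.1) / c) / c)
      ((poissonMeasure Δ).prod volume) := by
    rw [integrable_prod_iff]
    · refine ⟨ae_of_all _ fun k => (hGi k).comp_sub_div_div hc k, ?_⟩
      have h1 : ∀ (k : ℕ) (z : ℝ), ‖G k ((z - k) / c) / c‖ = G k ((z - k) / c) / c :=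
        fun k z => Real.norm_of_nonneg (div_nonneg (hG0 _ _) hc.le)
      simp_rw [h1, hint]
      exact i01.add i2
    · refine Measurable.aestronglyMeasurable (measurable_from_prod_countable_right fun k => ?_)
      exact ((hGm k).comp (by fun_prop : Measurable fun z : ℝ => (z - k) / c)).div_const c
  have hle : ∀ᵐ z, noisyIntegrand β c Δ z ≤
      ∫ k, G k ((z - k) / c) / c ∂(poissonMeasure Δ) := by
    filter_upwards [hprod.prod_left_ae] with z hz
    have hb : ∀ k : ℕ, 0 < stableDensity β ((z - k) / c) / c := fun k =>
      div_pos (hm.stableDensity_pos hβ _) hc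
    have heq : ∀ k : ℕ, (combinedScore β (k / c) ((z - k) / c) / c) ^ 2 /
        (stableDensity β ((z - k) / c) / c) = G k ((z - k) / c) / c := fun k => by
      have := hm.stableDensity_pos hβ ((z - k) / c)
      simp only [G]
      field_simp
    have hcs := sq_integral_le (μ := poissonMeasure Δ) (ae_of_all _ hb)
      (hm.integrable_combinedScore hβ hc Δ z) (hm.integrable_noisy hβ hc Δ z)
      (by simp_rw [heq]; exact hz)
    simp_rw [heq] at hcs
    rw [← hm.noisyDensity_add_mul_deriv hβ hc] at hcs
    unfold noisyIntegrand
    rw [div_le_iff₀' (hm.noisyDensity_pos hβ hc Δ z)]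
    exact hcs
  have hR := hprod.integral_prod_right
  have hi : Integrable (noisyIntegrand β c Δ) := by
    refine hR.mono' (hm.measurable_noisyIntegrand hβ hc.le Δ).aestronglyMeasurable ?_
    filter_upwards [hle] with z hz
    rwa [Real.norm_of_nonneg (hm.noisyIntegrand_nonneg hβ hc Δ z)]
  refine ⟨hi, ?_⟩
  calc _ ≤ ∫ z, ∫ k, G k ((z - k) / c) / c ∂(poissonMeasure Δ) := integral_mono_ae hi hR hle
    _ = ∫ k, (∫ z, G k ((z - k) / c) / c) ∂(poissonMeasure Δ) :=
      (integral_integral_swap (f := fun (k : ℕ) (z : ℝ) => G k ((z - k) / c) / c) hprod).symm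
    _ = _ := by
      simp_rw [hint]
      rw [integral_add i01 i2, integral_add (integrable_const _) i1, integral_const_mul,
        integral_const_mul, integral_poisson_natCast, integral_poisson_sq]
      simp
      ring

/-! ### The density near `0` and near `1` -/

lemma mul_noisyDensity_eq (hc : 0 < c) (Δ : ℝ≥0) (j w : ℝ) :
    c * noisyDensity β c Δ (j + c * w) =
      ∫ k : ℕ, stableDensity β (w + (j - k) / c) ∂(poissonMeasure Δ) := by
  rw [noisyDensity, ← integral_const_mul]
  congr 1; ext k
  rw [mul_div_cancel₀ _ hc.ne']
  congr 1; field_simp; ring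

lemma mul_noisyIntegrand_eq (hm : IsStableMixing β m) (hβ : 0 < β) (hc : 0 < c) (Δ : ℝ≥0)
    (j w : ℝ) :
    c * noisyIntegrand β c Δ (j + c * w) =
      (∫ k : ℕ, combinedScore β (k / c) (w + (j - k) / c) ∂(poissonMeasure Δ)) ^ 2 /
        ∫ k : ℕ, stableDensity β (w + (j - k) / c) ∂(poissonMeasure Δ) := by
  have h1 : c * (noisyDensity β c Δ (j + c * w) +
      (j + c * w) * deriv (noisyDensity β c Δ) (j + c * w)) =
      ∫ k : ℕ, combinedScore β (k / c) (w + (j - k) / c) ∂(poissonMeasure Δ) := by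
    rw [hm.noisyDensity_add_mul_deriv hβ hc, ← integral_const_mul]
    congr 1; ext k
    rw [mul_div_cancel₀ _ hc.ne']
    congr 1; field_simp; ring
  rw [← h1, ← mul_noisyDensity_eq hc, noisyIntegrand]
  have := hm.noisyDensity_pos hβ hc Δ (j + c * w)
  field_simp

end IsStableMixing

/-! ### The scale `Δ ^ (1 / β)` -/

/-- The scale `Δ ^ (1 / β)` of `W_Δ`. -/
def stableScale (β : ℝ) (Δ : ℝ≥0) : ℝ := (Δ : ℝ) ^ (1 / β)

/-- The square root `Δ ^ (1 / β - 1 / 2)` of the normalization of the Fisher information. -/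
def scaleRatio (β : ℝ) (Δ : ℝ≥0) : ℝ := (Δ : ℝ) ^ (1 / β - 1 / 2)

lemma stableScale_pos (β : ℝ) {Δ : ℝ≥0} (hΔ : 0 < Δ) : 0 < stableScale β Δ :=
  Real.rpow_pos_of_pos hΔ _

lemma stableScale_nonneg (β : ℝ) (Δ : ℝ≥0) : 0 ≤ stableScale β Δ := Real.rpow_nonneg Δ.coe_nonneg _

lemma scaleRatio_mul_sqrt (β : ℝ) {Δ : ℝ≥0} (hΔ : 0 < Δ) :
    scaleRatio β Δ * √(Δ : ℝ) = stableScale β Δ := by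
  have : (0 : ℝ) < Δ := hΔ
  rw [scaleRatio, stableScale, Real.sqrt_eq_rpow, ← Real.rpow_add this]
  congr 1; ring

lemma scaleRatio_sq_mul (β : ℝ) {Δ : ℝ≥0} (hΔ : 0 < Δ) :
    scaleRatio β Δ ^ 2 * Δ = stableScale β Δ ^ 2 := by
  rw [← scaleRatio_mul_sqrt β hΔ, mul_pow, Real.sq_sqrt Δ.coe_nonneg]

lemma scaleRatio_sq (β : ℝ) (Δ : ℝ≥0) :
    scaleRatio β Δ ^ 2 = (Δ : ℝ) ^ (2 / β - 1) := by
  rw [scaleRatio, ← Real.rpow_natCast, ← Real.rpow_mul Δ.coe_nonneg]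
  congr 1; push_cast; ring

lemma eventually_pos : ∀ᶠ Δ in 𝓝[>] (0 : ℝ≥0), 0 < Δ := self_mem_nhdsWithin

lemma tendsto_coe_nhdsGT : Tendsto (fun Δ : ℝ≥0 => (Δ : ℝ)) (𝓝[>] 0) (𝓝 0) :=
  (NNReal.continuous_coe.tendsto' 0 0 NNReal.coe_zero).mono_left nhdsWithin_le_nhds

lemma tendsto_coe_rpow {a : ℝ} (ha : 0 < a) :
    Tendsto (fun Δ : ℝ≥0 => (Δ : ℝ) ^ a) (𝓝[>] 0) (𝓝 0) := by
  have := tendsto_coe_nhdsGT.rpow_const (p := a) (Or.inr ha.le)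
  rwa [Real.zero_rpow ha.ne'] at this

lemma tendsto_stableScale {β : ℝ} (hβ : 0 < β) :
    Tendsto (stableScale β) (𝓝[>] 0) (𝓝 0) := tendsto_coe_rpow (by positivity)

lemma tendsto_inv_stableScale {β : ℝ} (hβ : 0 < β) :
    Tendsto (fun Δ => (stableScale β Δ)⁻¹) (𝓝[>] 0) atTop := by
  refine tendsto_inv_nhdsGT_zero.comp (tendsto_nhdsWithin_iff.2 ⟨tendsto_stableScale hβ, ?_⟩)
  filter_upwards [eventually_pos] with Δ hΔ using stableScale_pos β hΔ

lemma tendsto_sqrt_coe : Tendsto (fun Δ : ℝ≥0 => √(Δ : ℝ)) (𝓝[>] 0) (𝓝 0) := by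
  simpa using tendsto_coe_nhdsGT.sqrt

lemma tendsto_exp_neg_coe : Tendsto (fun Δ : ℝ≥0 => Real.exp (-Δ)) (𝓝[>] 0) (𝓝 1) := by
  simpa using tendsto_coe_nhdsGT.neg.rexp

namespace IsStableMixing

variable {β : ℝ} {m : Measure ℝ≥0}

/-- At distances of the order of a jump, the density of the stable part is negligible with respect
to the probability `Δ` of a jump. -/
lemma tendsto_stableDensity_div (hm : IsStableMixing β m) (hβ : 0 < β) {x : ℝ≥0 → ℝ} {a : ℝ}
    (ha : 0 < a) (hx : Tendsto (fun Δ => x Δ * stableScale β Δ) (𝓝[>] 0) (𝓝 a)) :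
    Tendsto (fun Δ => stableDensity β (x Δ) / Δ) (𝓝[>] 0) (𝓝 0) := by
  have hx' : Tendsto x (𝓝[>] 0) atTop := by
    refine (hx.pos_mul_atTop ha (tendsto_inv_stableScale hβ)).congr' ?_
    filter_upwards [eventually_pos] with Δ hΔ
    have := stableScale_pos β hΔ
    field_simp
  have h1 := (hm.tendsto_rpow_mul_stableDensity hβ).comp hx'
  have h2 := h1.div (hx.rpow_const (p := β) (Or.inl ha.ne')) (by positivity)
  rw [zero_div] at h2
  refine h2.congr' ?_
  filter_upwards [eventually_pos, hx'.eventually_gt_atTop 0] with Δ hΔ hxΔ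
  have hc : stableScale β Δ ^ β = Δ := by
    rw [stableScale, ← Real.rpow_mul Δ.coe_nonneg, one_div_mul_cancel hβ.ne', Real.rpow_one]
  have hΔ' : (0 : ℝ) < Δ := hΔ
  have : 0 < x Δ ^ β := Real.rpow_pos_of_pos hxΔ _
  simp only [Function.comp, Pi.div_apply]
  rw [Real.mul_rpow hxΔ.le (stableScale_nonneg β Δ), hc]
  field_simp

lemma tendsto_add_inv_mul_stableScale (hβ : 0 < β) (w : ℝ) :
    Tendsto (fun Δ => (w + (stableScale β Δ)⁻¹) * stableScale β Δ) (𝓝[>] 0) (𝓝 1) := by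
  have h := ((tendsto_stableScale hβ).const_mul w).add_const 1
  rw [mul_zero, zero_add] at h
  refine h.congr' ?_
  filter_upwards [eventually_pos] with Δ hΔ
  have := stableScale_pos β hΔ
  field_simp

lemma tendsto_stableDensity_add_div (hm : IsStableMixing β m) (hβ : 0 < β) (w : ℝ) :
    Tendsto (fun Δ => stableDensity β (w + (stableScale β Δ)⁻¹) / Δ) (𝓝[>] 0) (𝓝 0) :=
  hm.tendsto_stableDensity_div hβ one_pos (tendsto_add_inv_mul_stableScale hβ w)

lemma tendsto_combinedScore_add_div (hm : IsStableMixing β m) (hβ : 0 < β) (w : ℝ) :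
    Tendsto (fun Δ => stableScale β Δ / Δ *
      combinedScore β 0 (w + (stableScale β Δ)⁻¹)) (𝓝[>] 0) (𝓝 0) := by
  have h1 := hm.tendsto_stableDensity_add_div hβ w
  have h2 : Tendsto (fun Δ => stableDensity β ((w + (stableScale β Δ)⁻¹) / √2) / Δ)
      (𝓝[>] 0) (𝓝 0) := by
    refine hm.tendsto_stableDensity_div hβ (a := 1 / √2) (by positivity) ?_
    refine ((tendsto_add_inv_mul_stableScale hβ w).div_const √2).congr fun Δ => ?_
    ring
  have h3 := (tendsto_stableScale hβ).mul (h1.add (h2.const_mul 4))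
  simp only [mul_zero, add_zero] at h3
  refine squeeze_zero_norm' ?_ h3
  filter_upwards [eventually_pos] with Δ hΔ
  have hΔ' : (0 : ℝ) < Δ := hΔ
  have hc := stableScale_pos β hΔ
  set v := w + (stableScale β Δ)⁻¹
  have h4 : |combinedScore β 0 v| ≤ stableDensity β v + 4 * stableDensity β (v / √2) := by
    unfold combinedScore
    rw [zero_mul, add_zero]
    refine (abs_add_le _ _).trans ?_
    rw [abs_of_pos (hm.stableDensity_pos hβ v)]
    linarith [hm.abs_mul_deriv_stableDensity_le hβ v]
  rw [norm_mul, Real.norm_of_nonneg (by positivity), Real.norm_eq_abs]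
  calc _ ≤ stableScale β Δ / Δ * (stableDensity β v + 4 * stableDensity β (v / √2)) := by gcongr
    _ = _ := by ring

/-- Window at `0`: no jump has occurred. -/
lemma tendsto_window_zero (hm : IsStableMixing β m) (hβ : 0 < β) {κ : ℝ}
    (hκ : Tendsto (scaleRatio β) (𝓝[>] 0) (𝓝 κ)) (w : ℝ) :
    Tendsto (fun Δ => scaleRatio β Δ ^ 2 * (stableScale β Δ *
      noisyIntegrand β (stableScale β Δ) Δ (0 + stableScale β Δ * w))) (𝓝[>] 0)
      (𝓝 (κ ^ 2 * scaleIntegrand β w)) := by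
  obtain ⟨B, hB0, hB⟩ := hm.exists_bound hβ
  have hΔ0 := tendsto_coe_nhdsGT
  have hden : Tendsto (fun Δ : ℝ≥0 => ∫ k : ℕ,
      stableDensity β (w + (0 - k) / stableScale β Δ) ∂(poissonMeasure Δ)) (𝓝[>] 0)
      (𝓝 (stableDensity β w)) := by
    have hmain := tendsto_exp_neg_coe.mul_const (stableDensity β w)
    rw [one_mul] at hmain
    refine hmain.congr_dist ?_
    have hE : Tendsto (fun Δ : ℝ≥0 => (Δ : ℝ) * B + 2 * B * (Δ : ℝ) ^ 2) (𝓝[>] 0) (𝓝 0) := by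
      simpa using (hΔ0.mul_const B).add ((hΔ0.pow 2).const_mul (2 * B))
    refine squeeze_zero (fun _ => dist_nonneg) (fun Δ => ?_) hE
    have h := abs_integral_poisson_sub_le (r := Δ) hB0.le
      (f := fun k : ℕ => stableDensity β (w + (0 - k) / stableScale β Δ)) (fun k => by
        rw [abs_of_pos (hm.stableDensity_pos hβ _)]
        have := (hB (w + (0 - k) / stableScale β Δ)).1
        have : (0 : ℝ) ≤ B * k := by positivity
        linarith)
    simp only [Nat.cast_zero, sub_zero, zero_div, add_zero] at h
    rw [dist_comm, Real.dist_eq]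
    set f1 := stableDensity β (w + (0 - (1 : ℕ)) / stableScale β Δ)
    have hf1 : |Real.exp (-Δ) * Δ * f1| ≤ Δ * B := by
      rw [abs_of_nonneg (mul_nonneg (by positivity) (hm.stableDensity_pos hβ _).le)]
      have : Real.exp (-Δ) ≤ 1 := Real.exp_le_one_iff.2 (by simp)
      calc _ ≤ 1 * Δ * B := by
            gcongr
            · exact (hm.stableDensity_pos hβ _).le
            · exact (hB _).1
        _ = _ := by ring
    rw [abs_le] at h hf1 ⊢
    constructor <;> linarith
  have hnum : Tendsto (fun Δ : ℝ≥0 => scaleRatio β Δ * ∫ k : ℕ, combinedScore β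
      (k / stableScale β Δ) (w + (0 - k) / stableScale β Δ) ∂(poissonMeasure Δ)) (𝓝[>] 0)
      (𝓝 (κ * combinedScore β 0 w)) := by
    have hmain := (hκ.mul tendsto_exp_neg_coe).mul_const (combinedScore β 0 w)
    rw [mul_one] at hmain
    refine hmain.congr_dist ?_
    have hE : Tendsto (fun Δ : ℝ≥0 => 2 * B * (scaleRatio β Δ * Δ + √(Δ : ℝ)) * (1 + Δ))
        (𝓝[>] 0) (𝓝 0) := by
      have := (((hκ.mul hΔ0).add tendsto_sqrt_coe).const_mul (2 * B)).mul (hΔ0.const_add 1)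
      simpa using this
    refine squeeze_zero' (Eventually.of_forall fun _ => dist_nonneg) ?_ hE
    filter_upwards [eventually_pos] with Δ hΔ
    have hc := stableScale_pos β hΔ
    have hΔ' : (0 : ℝ) < Δ := hΔ
    have hr : 0 < scaleRatio β Δ := Real.rpow_pos_of_pos hΔ' _
    have hC : ∀ k : ℕ, |combinedScore β (k / stableScale β Δ)
        (w + (0 - k) / stableScale β Δ)| ≤ B * (1 + (stableScale β Δ)⁻¹) * (1 + k) := by
      intro k
      refine (abs_combinedScore_le hB _ _).trans ?_
      rw [abs_of_nonneg (by positivity), mul_assoc, div_eq_mul_inv]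
      gcongr
      have h1 : 0 < (stableScale β Δ)⁻¹ := by positivity
      have h2 : (0 : ℝ) ≤ k := by positivity
      nlinarith
    have h := abs_integral_poisson_sub_le (r := Δ) (by positivity) hC
    have h1 := hC 1
    simp only [Nat.cast_zero, sub_zero, zero_div, add_zero] at h
    rw [dist_comm, Real.dist_eq]
    set f1 := combinedScore β ((1 : ℕ) / stableScale β Δ) (w + (0 - (1 : ℕ)) / stableScale β Δ)
    set I := ∫ k : ℕ, combinedScore β
      (k / stableScale β Δ) (w + (0 - k) / stableScale β Δ) ∂(poissonMeasure Δ)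
    set K := B * (1 + (stableScale β Δ)⁻¹) with hK
    have hf1 : |Real.exp (-Δ) * Δ * f1| ≤ Δ * (2 * K) := by
      rw [abs_mul, abs_of_nonneg (by positivity)]
      have : Real.exp (-Δ) ≤ 1 := Real.exp_le_one_iff.2 (by simp)
      calc _ ≤ 1 * Δ * (K * (1 + (1 : ℕ))) := by gcongr
        _ = _ := by push_cast; ring
    have h2 : |I - Real.exp (-Δ) * combinedScore β 0 w| ≤ 2 * K * Δ * (1 + Δ) := by
      rw [abs_le] at h hf1 ⊢
      constructor <;> linarith
    have h3 : scaleRatio β Δ * (K * Δ) = B * (scaleRatio β Δ * Δ + √(Δ : ℝ)) := by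
      rw [hK, ← scaleRatio_mul_sqrt β hΔ]
      have h4 : 0 < √(Δ : ℝ) := Real.sqrt_pos.2 hΔ'
      have h5 : (Δ : ℝ) = √(Δ : ℝ) ^ 2 := (Real.sq_sqrt hΔ'.le).symm
      generalize √(Δ : ℝ) = s at *
      rw [h5]
      field_simp
    calc |scaleRatio β Δ * I - scaleRatio β Δ * Real.exp (-Δ) * combinedScore β 0 w|
        = scaleRatio β Δ * |I - Real.exp (-Δ) * combinedScore β 0 w| := by
          rw [mul_assoc, ← mul_sub, abs_mul, abs_of_pos hr]
      _ ≤ scaleRatio β Δ * (2 * K * Δ * (1 + Δ)) := by gcongr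
      _ = 2 * (scaleRatio β Δ * (K * Δ)) * (1 + Δ) := by ring
      _ = _ := by rw [h3]; ring
  have h := (hnum.pow 2).div hden (hm.stableDensity_pos hβ w).ne'
  have heq : (κ * combinedScore β 0 w) ^ 2 / stableDensity β w = κ ^ 2 * scaleIntegrand β w := by
    unfold combinedScore scaleIntegrand; ring
  rw [heq] at h
  refine h.congr' ?_
  filter_upwards [eventually_pos] with Δ hΔ
  rw [hm.mul_noisyIntegrand_eq hβ (stableScale_pos β hΔ), Pi.div_apply, mul_pow, mul_div_assoc]

/-- Window at `1`: one jump has occurred. -/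
lemma tendsto_window_one (hm : IsStableMixing β m) (hβ : 0 < β) (w : ℝ) :
    Tendsto (fun Δ => scaleRatio β Δ ^ 2 * (stableScale β Δ *
      noisyIntegrand β (stableScale β Δ) Δ (1 + stableScale β Δ * w))) (𝓝[>] 0)
      (𝓝 (translationIntegrand β w)) := by
  obtain ⟨B, hB0, hB⟩ := hm.exists_bound hβ
  have hΔ0 := tendsto_coe_nhdsGT
  have hden : Tendsto (fun Δ : ℝ≥0 => (∫ k : ℕ,
      stableDensity β (w + (1 - k) / stableScale β Δ) ∂(poissonMeasure Δ)) / Δ) (𝓝[>] 0)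
      (𝓝 (stableDensity β w)) := by
    have hmain := (tendsto_exp_neg_coe.mul (hm.tendsto_stableDensity_add_div hβ w)).add
      (tendsto_exp_neg_coe.mul_const (stableDensity β w))
    simp only [one_mul, mul_zero, zero_add] at hmain
    refine hmain.congr_dist ?_
    have hE : Tendsto (fun Δ : ℝ≥0 => 2 * B * (Δ : ℝ)) (𝓝[>] 0) (𝓝 0) := by
      simpa using hΔ0.const_mul (2 * B)
    refine squeeze_zero' (Eventually.of_forall fun _ => dist_nonneg) ?_ hE
    filter_upwards [eventually_pos] with Δ hΔ
    have hΔ' : (0 : ℝ) < Δ := hΔ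
    have h := abs_integral_poisson_sub_le (r := Δ) hB0.le
      (f := fun k : ℕ => stableDensity β (w + (1 - k) / stableScale β Δ)) (fun k => by
        rw [abs_of_pos (hm.stableDensity_pos hβ _)]
        have := (hB (w + (1 - k) / stableScale β Δ)).1
        have : (0 : ℝ) ≤ B * k := by positivity
        linarith)
    simp only [Nat.cast_zero, Nat.cast_one, sub_zero, sub_self, zero_div, add_zero, one_div] at h
    rw [dist_comm, Real.dist_eq]
    set I := ∫ k : ℕ, stableDensity β (w + (1 - k) / stableScale β Δ) ∂(poissonMeasure Δ)
    have heq : I / Δ - (Real.exp (-Δ) * (stableDensity β (w + (stableScale β Δ)⁻¹) / Δ) +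
        Real.exp (-Δ) * stableDensity β w) =
        (I - Real.exp (-Δ) * stableDensity β (w + (stableScale β Δ)⁻¹) -
          Real.exp (-Δ) * Δ * stableDensity β w) / Δ := by
      field_simp
      ring
    rw [heq, abs_div, abs_of_pos hΔ', div_le_iff₀ hΔ']
    refine h.trans (le_of_eq ?_)
    ring
  have hnum : Tendsto (fun Δ : ℝ≥0 => stableScale β Δ / Δ * ∫ k : ℕ, combinedScore β
      (k / stableScale β Δ) (w + (1 - k) / stableScale β Δ) ∂(poissonMeasure Δ)) (𝓝[>] 0)
      (𝓝 (deriv (stableDensity β) w)) := by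
    have hone : Tendsto (fun Δ => stableScale β Δ * combinedScore β (stableScale β Δ)⁻¹ w)
        (𝓝[>] 0) (𝓝 (deriv (stableDensity β) w)) := by
      have := ((tendsto_stableScale hβ).mul_const (combinedScore β 0 w)).add_const
        (deriv (stableDensity β) w)
      rw [zero_mul, zero_add] at this
      refine this.congr' ?_
      filter_upwards [eventually_pos] with Δ hΔ
      have hc := stableScale_pos β hΔ
      unfold combinedScore
      field_simp
      ring
    have hmain := (tendsto_exp_neg_coe.mul (hm.tendsto_combinedScore_add_div hβ w)).add
      (tendsto_exp_neg_coe.mul hone)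
    simp only [one_mul, mul_zero, zero_add] at hmain
    refine hmain.congr_dist ?_
    have hE : Tendsto (fun Δ : ℝ≥0 => 2 * B * (stableScale β Δ + 1) * (Δ : ℝ)) (𝓝[>] 0)
        (𝓝 0) := by
      have := (((tendsto_stableScale hβ).add_const 1).const_mul (2 * B)).mul hΔ0
      simpa using this
    refine squeeze_zero' (Eventually.of_forall fun _ => dist_nonneg) ?_ hE
    filter_upwards [eventually_pos] with Δ hΔ
    have hc := stableScale_pos β hΔ
    have hΔ' : (0 : ℝ) < Δ := hΔ
    have hC : ∀ k : ℕ, |combinedScore β (k / stableScale β Δ)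
        (w + (1 - k) / stableScale β Δ)| ≤ B * (1 + (stableScale β Δ)⁻¹) * (1 + k) := by
      intro k
      refine (abs_combinedScore_le hB _ _).trans ?_
      rw [abs_of_nonneg (by positivity), mul_assoc, div_eq_mul_inv]
      gcongr
      have h1 : 0 < (stableScale β Δ)⁻¹ := by positivity
      have h2 : (0 : ℝ) ≤ k := by positivity
      nlinarith
    have h := abs_integral_poisson_sub_le (r := Δ) (by positivity) hC
    simp only [Nat.cast_zero, Nat.cast_one, sub_zero, sub_self, zero_div, add_zero, one_div] at h
    rw [dist_comm, Real.dist_eq]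
    set I := ∫ k : ℕ, combinedScore β
      (k / stableScale β Δ) (w + (1 - k) / stableScale β Δ) ∂(poissonMeasure Δ)
    have heq : stableScale β Δ / Δ * I - (Real.exp (-Δ) * (stableScale β Δ / Δ *
        combinedScore β 0 (w + (stableScale β Δ)⁻¹)) +
        Real.exp (-Δ) * (stableScale β Δ * combinedScore β (stableScale β Δ)⁻¹ w)) =
        stableScale β Δ / Δ * (I - Real.exp (-Δ) * combinedScore β 0 (w + (stableScale β Δ)⁻¹) -
          Real.exp (-Δ) * Δ * combinedScore β (stableScale β Δ)⁻¹ w) := by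
      field_simp
      ring
    rw [heq, abs_mul, abs_of_pos (by positivity)]
    calc _ ≤ stableScale β Δ / Δ * (2 * (B * (1 + (stableScale β Δ)⁻¹)) * (Δ : ℝ) ^ 2) := by gcongr
      _ = _ := by field_simp
  have h := (hnum.pow 2).div hden (hm.stableDensity_pos hβ w).ne'
  refine h.congr' ?_
  filter_upwards [eventually_pos] with Δ hΔ
  have hΔ' : (0 : ℝ) < Δ := hΔ
  rw [hm.mul_noisyIntegrand_eq hβ (stableScale_pos β hΔ), Pi.div_apply, mul_pow, div_pow,
    ← scaleRatio_sq_mul β hΔ]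
  field_simp

end IsStableMixing

/-! ### The lower bound -/

/-- The restrictions of `g` to the disjoint windows around `0` and `1`, both in the coordinate `w`
given by `z = j + c w`. -/
def windowed (g : ℝ → ℝ) (c w : ℝ) : ℝ :=
  c * ((Set.Ioo (-1 / 2) (1 / 2)).indicator g (0 + c * w) +
    (Set.Ioo (1 / 2) (3 / 2)).indicator g (1 + c * w))

lemma integral_comp_add_mul (f : ℝ → ℝ) {c : ℝ} (hc : 0 < c) (a : ℝ) :
    ∫ w, c * f (a + c * w) = ∫ z, f z := by
  rw [integral_const_mul, Measure.integral_comp_mul_left (fun z => f (a + z)) c,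
    integral_add_left_eq_self f a, abs_of_pos (inv_pos.2 hc), smul_eq_mul, ← mul_assoc,
    mul_inv_cancel₀ hc.ne', one_mul]

lemma windowed_nonneg {g : ℝ → ℝ} (h0 : ∀ z, 0 ≤ g z) {c : ℝ} (hc : 0 ≤ c) (w : ℝ) :
    0 ≤ windowed g c w :=
  mul_nonneg hc (add_nonneg (Set.indicator_nonneg (fun z _ => h0 z) _)
    (Set.indicator_nonneg (fun z _ => h0 z) _))

lemma measurable_windowed {g : ℝ → ℝ} (hg : Measurable g) (c : ℝ) : Measurable (windowed g c) := by
  have h1 := hg.indicator (measurableSet_Ioo (a := (-1 / 2 : ℝ)) (b := 1 / 2))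
  have h2 := hg.indicator (measurableSet_Ioo (a := (1 / 2 : ℝ)) (b := 3 / 2))
  exact ((h1.comp (by fun_prop)).add (h2.comp (by fun_prop))).const_mul c

lemma integral_windowed_le {g : ℝ → ℝ} (hg : Integrable g) (h0 : ∀ z, 0 ≤ g z) {c : ℝ}
    (hc : 0 < c) : Integrable (windowed g c) ∧ ∫ w, windowed g c w ≤ ∫ z, g z := by
  have h1 := hg.indicator (measurableSet_Ioo (a := (-1 / 2 : ℝ)) (b := 1 / 2))
  have h2 := hg.indicator (measurableSet_Ioo (a := (1 / 2 : ℝ)) (b := 3 / 2))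
  have i1 := ((h1.comp_add_left 0).comp_mul_left' hc.ne').const_mul c
  have i2 := ((h2.comp_add_left 1).comp_mul_left' hc.ne').const_mul c
  have heq : windowed g c = fun w =>
      c * (Set.Ioo (-1 / 2) (1 / 2)).indicator g (0 + c * w) +
        c * (Set.Ioo (1 / 2) (3 / 2)).indicator g (1 + c * w) := by
    ext w; exact mul_add _ _ _
  rw [heq]
  refine ⟨i1.add i2, ?_⟩
  rw [integral_add i1 i2, integral_comp_add_mul _ hc, integral_comp_add_mul _ hc,
    ← integral_add h1 h2]
  refine integral_mono (h1.add h2) hg fun z => ?_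
  simp only [Set.indicator, Set.mem_Ioo]
  have := h0 z
  split_ifs with ha hb hb
  · linarith [ha.2, hb.1]
  all_goals linarith

namespace IsStableMixing

variable {β : ℝ} {m : Measure ℝ≥0}

lemma tendsto_windowed (hm : IsStableMixing β m) (hβ : 0 < β) {κ : ℝ}
    (hκ : Tendsto (scaleRatio β) (𝓝[>] 0) (𝓝 κ)) (w : ℝ) :
    Tendsto (fun Δ => scaleRatio β Δ ^ 2 *
      windowed (noisyIntegrand β (stableScale β Δ) Δ) (stableScale β Δ) w) (𝓝[>] 0)
      (𝓝 (κ ^ 2 * scaleIntegrand β w + translationIntegrand β w)) := by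
  refine ((hm.tendsto_window_zero hβ hκ w).add (hm.tendsto_window_one hβ w)).congr' ?_
  have hcw : Tendsto (fun Δ => stableScale β Δ * w) (𝓝[>] 0) (𝓝 0) := by
    simpa using (tendsto_stableScale hβ).mul_const w
  filter_upwards [hcw (Ioo_mem_nhds (by norm_num : (-1 / 2 : ℝ) < 0) (by norm_num : 0 < (1 / 2 : ℝ)))]
    with Δ hΔ
  have h : -1 / 2 < stableScale β Δ * w ∧ stableScale β Δ * w < 1 / 2 := hΔ
  rw [windowed, Set.indicator_of_mem, Set.indicator_of_mem]
  · ring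
  · constructor <;> linarith
  · constructor <;> linarith

/-- Fatou's lemma gives the lower bound and `integrable_noisyIntegrand` the matching upper one. -/
theorem tendsto_integral_noisyIntegrand (hm : IsStableMixing β m) (hβ : 0 < β) {κ : ℝ}
    (hκ : Tendsto (scaleRatio β) (𝓝[>] 0) (𝓝 κ)) :
    Tendsto (fun Δ => scaleRatio β Δ ^ 2 * ∫ z, noisyIntegrand β (stableScale β Δ) Δ z) (𝓝[>] 0)
      (𝓝 (κ ^ 2 * scaleInformation β + translationInformation β)) := by
  set L := κ ^ 2 * scaleInformation β + translationInformation β with hL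
  have hlim_nonneg : ∀ w, 0 ≤ κ ^ 2 * scaleIntegrand β w + translationIntegrand β w := fun w =>
    add_nonneg (mul_nonneg (sq_nonneg _) (hm.scaleIntegrand_nonneg hβ w))
      (hm.translationIntegrand_nonneg hβ w)
  have hlim_int : Integrable fun w => κ ^ 2 * scaleIntegrand β w + translationIntegrand β w :=
    ((hm.integrable_scaleIntegrand hβ).const_mul _).add (hm.integrable_translationIntegrand hβ)
  have hL_eq : ∫ w, (κ ^ 2 * scaleIntegrand β w + translationIntegrand β w) = L := by
    rw [integral_add ((hm.integrable_scaleIntegrand hβ).const_mul _)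
      (hm.integrable_translationIntegrand hβ), integral_const_mul]
    rfl
  have hL0 : 0 ≤ L := hL_eq ▸ integral_nonneg hlim_nonneg
  set E : ℝ≥0 → ℝ := fun Δ => scaleRatio β Δ ^ 2 * ∫ z, noisyIntegrand β (stableScale β Δ) Δ z
  have hlower : ENNReal.ofReal L ≤ liminf (fun Δ => ENNReal.ofReal (E Δ)) (𝓝[>] 0) := by
    calc ENNReal.ofReal L
        = ∫⁻ w, ENNReal.ofReal (κ ^ 2 * scaleIntegrand β w + translationIntegrand β w) := by
          rw [← hL_eq, ofReal_integral_eq_lintegral_ofReal hlim_int (ae_of_all _ hlim_nonneg)]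
      _ = ∫⁻ w, liminf (fun Δ => ENNReal.ofReal (scaleRatio β Δ ^ 2 *
            windowed (noisyIntegrand β (stableScale β Δ) Δ) (stableScale β Δ) w)) (𝓝[>] 0) :=
          lintegral_congr fun w =>
            (ENNReal.tendsto_ofReal (hm.tendsto_windowed hβ hκ w)).liminf_eq.symm
      _ ≤ liminf (fun Δ => ∫⁻ w, ENNReal.ofReal (scaleRatio β Δ ^ 2 *
            windowed (noisyIntegrand β (stableScale β Δ) Δ) (stableScale β Δ) w)) (𝓝[>] 0) :=
          lintegral_liminf_le fun Δ => ((measurable_windowed (hm.measurable_noisyIntegrand hβ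
            (stableScale_nonneg β Δ) Δ) _).const_mul _).ennreal_ofReal
      _ ≤ _ := by
          refine liminf_le_liminf ?_
          filter_upwards [eventually_pos] with Δ hΔ
          have hc := stableScale_pos β hΔ
          have h0 := hm.noisyIntegrand_nonneg hβ hc Δ
          obtain ⟨hi, hle⟩ := integral_windowed_le (hm.integrable_noisyIntegrand hβ hc Δ).1 h0 hc
          rw [← ofReal_integral_eq_lintegral_ofReal (hi.const_mul _) (ae_of_all _ fun w =>
            mul_nonneg (sq_nonneg _) (windowed_nonneg h0 hc.le w)), integral_const_mul]
          exact ENNReal.ofReal_le_ofReal (mul_le_mul_of_nonneg_left hle (sq_nonneg _))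
  have hupper : limsup (fun Δ => ENNReal.ofReal (E Δ)) (𝓝[>] 0) ≤ ENNReal.ofReal L := by
    have hU : Tendsto (fun Δ : ℝ≥0 => scaleRatio β Δ ^ 2 * scaleInformation β +
        2 * stableScale β Δ * (∫ v, crossIntegrand β v) +
          ((Δ : ℝ) + 1) * translationInformation β) (𝓝[>] 0) (𝓝 L) := by
      have := (((hκ.pow 2).mul_const (scaleInformation β)).add
        (((tendsto_stableScale hβ).const_mul 2).mul_const (∫ v, crossIntegrand β v))).add
        ((tendsto_coe_nhdsGT.add_const 1).mul_const (translationInformation β))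
      simpa [hL] using this
    rw [← (ENNReal.tendsto_ofReal hU).limsup_eq]
    refine limsup_le_limsup ?_
    filter_upwards [eventually_pos] with Δ hΔ
    have hc := stableScale_pos β hΔ
    have hΔ' : (0 : ℝ) < Δ := hΔ
    refine ENNReal.ofReal_le_ofReal ?_
    have h := mul_le_mul_of_nonneg_left (hm.integrable_noisyIntegrand hβ hc Δ).2
      (sq_nonneg (scaleRatio β Δ))
    refine h.trans (le_of_eq ?_)
    have hk : scaleRatio β Δ ^ 2 = stableScale β Δ ^ 2 / Δ := by
      rw [← scaleRatio_sq_mul β hΔ]; field_simp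
    rw [hk]
    field_simp
  have hT := tendsto_of_le_liminf_of_limsup_le hlower hupper
  have hT' := (ENNReal.tendsto_toReal ENNReal.ofReal_ne_top).comp hT
  rw [ENNReal.toReal_ofReal hL0] at hT'
  refine hT'.congr' ?_
  filter_upwards [eventually_pos] with Δ hΔ
  exact ENNReal.toReal_ofReal (mul_nonneg (sq_nonneg _)
    (integral_nonneg (hm.noisyIntegrand_nonneg hβ (stableScale_pos β hΔ) Δ)))

end IsStableMixing

end LevyFisher

end

theorem theorem9 {Ω : Type*} [MeasurableSpace Ω] (P : Measure Ω) [IsProbabilityMeasure P]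
    (β σ : ℝ) (hβ : 0 < β) (hβ2 : β ≤ 2) (hσ : 0 < σ) (W Y : ℝ≥0 → Ω → ℝ)
    (hW : LevyFisher.IsSymmetricStableProcess β W P)
    (hY : LevyFisher.IsStandardPoissonProcess Y P)
    (hWY : IndepFun (fun ω t => W t ω) (fun ω t => Y t ω) P) :
    -- `h_β` is the density of `W₁`, and the constants `𝓘(β)`, `𝓙(β)` are well defined
    (LevyFisher.IsContinuousDensity (P.map (W 1)) (LevyFisher.stableDensity β) ∧
      (∀ w, 0 < LevyFisher.stableDensity β w) ∧
      Differentiable ℝ (LevyFisher.stableDensity β) ∧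
      Integrable (LevyFisher.scaleIntegrand β) ∧
      Integrable (LevyFisher.translationIntegrand β)) ∧
    -- the Fisher information for `σ` of the observation of `X_Δ` exists and is finite
    (∀ Δ : ℝ≥0, 0 < Δ →
      LevyFisher.HasFiniteFisherInformation (LevyFisher.multiplicativeLaw P W Y Δ) σ) ∧
    -- its behaviour as `Δ → 0`
    (β = 2 →
      Tendsto
        (fun Δ : ℝ≥0 =>
          LevyFisher.fisherInformation (LevyFisher.multiplicativeLaw P W Y Δ) σ)
        (𝓝[>] 0)
        (𝓝 ((LevyFisher.scaleInformation β + LevyFisher.translationInformation β) / σ ^ 2))) ∧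
    (β < 2 →
      Tendsto
        (fun Δ : ℝ≥0 => (Δ : ℝ) ^ (2 / β - 1) *
          LevyFisher.fisherInformation (LevyFisher.multiplicativeLaw P W Y Δ) σ)
        (𝓝[>] 0)
        (𝓝 (LevyFisher.translationInformation β / σ ^ 2))) := by
  obtain ⟨m, hm⟩ := LevyFisher.exists_isStableMixing hβ hβ2
  have hlim : ∀ κ : ℝ, Tendsto (LevyFisher.scaleRatio β) (𝓝[>] 0) (𝓝 κ) →
      Tendsto (fun Δ : ℝ≥0 => (Δ : ℝ) ^ (2 / β - 1) *
        LevyFisher.fisherInformation (LevyFisher.multiplicativeLaw P W Y Δ) σ) (𝓝[>] 0)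
        (𝓝 ((κ ^ 2 * LevyFisher.scaleInformation β +
          LevyFisher.translationInformation β) / σ ^ 2)) := by
    intro κ hκ
    refine ((hm.tendsto_integral_noisyIntegrand hβ hκ).div_const (σ ^ 2)).congr' ?_
    filter_upwards [LevyFisher.eventually_pos] with Δ hΔ
    rw [LevyFisher.fisherInformation_multiplicativeLaw hm hβ hW hY hWY hΔ hσ,
      LevyFisher.scaleRatio_sq, mul_div_assoc]
    rfl
  refine ⟨⟨?_, hm.stableDensity_pos hβ, hm.differentiable_stableDensity hβ,
    hm.integrable_scaleIntegrand hβ, hm.integrable_translationIntegrand hβ⟩, fun Δ hΔ => ?_,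
    fun h2 => ?_, fun h2 => ?_⟩
  · have : IsProbabilityMeasure (P.map (W 1)) :=
      Measure.isProbabilityMeasure_map (hW.measurable 1).aemeasurable
    exact hm.isContinuousDensity hβ fun u => by simpa using hW.charFun_eq 1 u
  · exact LevyFisher.hasFiniteFisherInformation_of_integrable hm hβ hW hY hWY hΔ hσ
      (hm.integrable_noisyIntegrand hβ (LevyFisher.stableScale_pos β hΔ) Δ).1
  · have h := hlim 1 (by
      have : LevyFisher.scaleRatio β = fun _ => 1 := by
        ext Δ; simp [LevyFisher.scaleRatio, h2]
      rw [this]; exact tendsto_const_nhds)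
    have h3 : 2 / β - 1 = 0 := by rw [h2]; norm_num
    simpa [h3] using h
  · have h := hlim 0 (LevyFisher.tendsto_coe_rpow (by
      rw [sub_pos]; exact one_div_lt_one_div_of_lt hβ h2))
    simpa using h
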